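/- For a positive integer $n$ let $[n]=\{1,\dots,n\}$. A permutation $\sigma$ of length $|\sigma|=n\ge 1$ is a bijection $\sigma:[n]\to[n]$. A permutation sequence is a sequence $(\sigma_n)_{n\in\mathbb N}$ of permutations of arbitrary positive lengths. For permutations $\tau$ of length $k$ and $\pi$ of length $n$, let $\Lambda(\tau,\pi)$ be the number of $k$-tuples $x_1<\dots<x_k$ in $[n]$ such that, for all $i,j\in[k]$, $\pi(x_i)<\pi(x_j)$ if and only if $\tau(i)<\tau(j)$. Let $t(\tau,\pi)=\binom nk^{-1}\Lambda(\tau,\pi)$ if $k\le n$, and $t(\tau,\pi)=0$ if $k>n$. A permutation sequence $(\sigma_n)$ converges if, for every permutation $\tau$, the real sequence $(t(\tau,\sigma_n))_{n\in\mathbb N}$ converges. A cdf is a non-decreasing left-continuous function $F:[0,1]\to[0,1]$ with $F(0)=0$; let $\mu_F$ be the Borel probability measure on $[0,1]$ with $\mu_F([a,b))=F(b)-F(a)$ for $0\le a<b\le 1$. For a permutation $\sigma$ of length $n$ define $Z_\sigma:[0,1]^2\to[0,1]$ by $Z_\sigma(x,0)=0$; $Z_\sigma(0,y)=\lceil ny\rceil/n$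 for $y>0$; and, for $x,y>0$, $Z_\sigma(x,y)=1$ if $\sigma(\lceil nx\rceil)<\lceil ny\rceil$ and $Z_\sigma(x,y)=0$ otherwise. Each $Z_\sigma(x,\cdot)$ is a cdf. The rectangular distance between two permutations $\sigma,\pi$, of possibly different lengths, is $$d_\square(\sigma,\pi)=\sup_{\substack{x_1<x_2\in[0,1]\\ \alpha_1<\alpha_2\in[0,1]}}\left|\int_{x_1}^{x_2}\mu_{Z_\sigma(x,\cdot)}([\alpha_1,\alpha_2])\,dx-\int_{x_1}^{x_2}\mu_{Z_\pi(x,\cdot)}([\alpha_1,\alpha_2])\,dx\right| .$$ **Theorem 1.6.** A permutation sequence $(\sigma_n)_{n\in\mathbb N}$ converges if and only if it is a Cauchy sequence with respect to $d_\square$, that is, for every $\varepsilon>0$ there is $n_0$ such that $d_\square(\sigma_n,\sigma_m)<\varepsilon$ for all $n,m\ge n_0$. -/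

import Mathlib

open Filter Topology MeasureTheory

/-- A finite permutation `σ`: a positive length `n = |σ|` together with a permutation of an
`n`-element linear order.  The element `i : Fin n` stands for the element `i + 1` of
`[n] = {1, …, n}`. -/
structure FinPerm where
  length : ℕ
  length_pos : 0 < length
  perm : Equiv.Perm (Fin length)

namespace FinPerm

/-- The number of occurrences of `τ` (of length `k`) in `π` (of length `n`): the number of
strictly increasing `k`-tuples `x` in `[n]` with `π (x i) < π (x j) ↔ τ i < τ j` for all `i, j`. -/
noncomputable def occurrences (τ π : FinPerm) : ℕ :=
  Set.ncard {x : Fin τ.length → Fin π.length |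
    StrictMono x ∧ ∀ i j, π.perm (x i) < π.perm (x j) ↔ τ.perm i < τ.perm j}

/-- The density of `τ` as a subpermutation of `π`. -/
noncomputable def density (τ π : FinPerm) : ℝ :=
  if τ.length ≤ π.length then
    (occurrences τ π : ℝ) / (Nat.choose π.length τ.length : ℝ)
  else 0

/-- A permutation sequence is convergent if every subpermutation density converges. -/
def Convergent (σ : ℕ → FinPerm) : Prop :=
  ∀ τ : FinPerm, ∃ l : ℝ, Tendsto (fun n => density τ (σ n)) atTop (𝓝 l)

end FinPerm

/-- A cumulative distribution function on `[0,1]`: a non-decreasing left-continuous function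
`[0,1] → [0,1]` vanishing at `0`.  (Non-negativity follows from monotonicity.) -/
structure UnitCdf where
  toFun : unitInterval → ℝ
  mono : Monotone toFun
  left_cont : ∀ y, ContinuousWithinAt toFun (Set.Iic y) y
  map_zero : toFun 0 = 0
  le_one : ∀ y, toFun y ≤ 1

namespace UnitCdf

/-- The extension of a cdf to the real line: `0` on `(-∞, 0]`, and `1` on `(1, ∞)`. -/
noncomputable def extend (F : UnitCdf) (y : ℝ) : ℝ :=
  if y ≤ 1 then F.toFun (Set.projIcc 0 1 zero_le_one y) else 1

theorem extend_mono (F : UnitCdf) : Monotone F.extend := by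
  intro a b hab
  unfold extend
  split_ifs with h1 h2
  · exact F.mono (Set.monotone_projIcc _ hab)
  · exact F.le_one _
  · exact absurd (hab.trans (by assumption)) h1
  · exact le_rfl

/-- The Lebesgue–Stieltjes probability measure `μ_F` of a cdf `F`, as a measure on `ℝ`
concentrated on `[0,1]`; it satisfies `μ_F [a, b) = F b - F a` for `0 ≤ a < b ≤ 1`, and
`μ_F [0, 1] = 1` (a possible defect `1 - F 1` is an atom at `1`). -/
noncomputable def measure (F : UnitCdf) : Measure ℝ :=
  F.extend_mono.stieltjesFunction.measure

end UnitCdf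

/-- The rectangular distance between `Z₁` and `Z₂`, where `Z x` is a cdf for every `x ∈ [0,1]`:
the supremum over `x₁ < x₂` and `α₁ < α₂` in `[0,1]` of
`|∫_{x₁}^{x₂} ∫_{[α₁,α₂]} dZ₁(x,·) dx - ∫_{x₁}^{x₂} ∫_{[α₁,α₂]} dZ₂(x,·) dx|`. -/
noncomputable def cdfRectDist (Z₁ Z₂ : unitInterval → UnitCdf) : ℝ :=
  sSup {r : ℝ | ∃ x₁ x₂ α₁ α₂ : unitInterval, x₁ < x₂ ∧ α₁ < α₂ ∧
    r = |(∫ x in Set.Icc x₁ x₂, (Z₁ x).measure.real (Set.Icc (α₁ : ℝ) (α₂ : ℝ))) -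
          ∫ x in Set.Icc x₁ x₂, (Z₂ x).measure.real (Set.Icc (α₁ : ℝ) (α₂ : ℝ))|}

namespace FinPerm

/-- For `0 < x ≤ 1`, the element `⌈n x⌉` of `[n]`, that is, the index `⌈n x⌉ - 1` of `Fin n`.
(The value at `x = 0` is never used.) -/
noncomputable def cell (σ : FinPerm) (x : unitInterval) : Fin σ.length :=
  ⟨⌈(σ.length : ℝ) * x⌉₊ - 1, by
    have h : ⌈(σ.length : ℝ) * x⌉₊ ≤ σ.length :=
      Nat.ceil_le.2 (mul_le_of_le_one_right (Nat.cast_nonneg _) x.2.2)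
    have := σ.length_pos
    omega⟩

/-- The bipartite adjacency matrix of the graph of `σ`: `Q_σ(a, b) = 1` if `σ(a) < b`, and `0`
otherwise. -/
noncomputable def adjMatrix (σ : FinPerm) (a b : Fin σ.length) : ℝ :=
  if σ.perm a < b then 1 else 0

/-- The step function `Z_σ(x, y)`: it is `0` if `y = 0`, it is `⌈n y⌉ / n` if `x = 0`, and it is
`Q_σ(⌈n x⌉, ⌈n y⌉)` otherwise. -/
noncomputable def stepValue (σ : FinPerm) (x y : unitInterval) : ℝ :=
  if y = 0 then 0
  else if x = 0 then (⌈(σ.length : ℝ) * y⌉₊ : ℝ) / σ.length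
  else σ.adjMatrix (σ.cell x) (σ.cell y)

theorem stepValue_nonneg (σ : FinPerm) (x y : unitInterval) : 0 ≤ σ.stepValue x y := by
  unfold stepValue adjMatrix
  split_ifs <;> positivity

theorem stepValue_le_one (σ : FinPerm) (x y : unitInterval) : σ.stepValue x y ≤ 1 := by
  unfold stepValue adjMatrix
  have h : (⌈(σ.length : ℝ) * y⌉₊ : ℝ) ≤ σ.length :=
    Nat.cast_le.2 (Nat.ceil_le.2 (mul_le_of_le_one_right (Nat.cast_nonneg _) y.2.2))
  split_ifs
  · exact zero_le_one
  · exact div_le_one_of_le₀ h (Nat.cast_nonneg _)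
  · exact le_rfl
  · exact zero_le_one

theorem ceil_mono (σ : FinPerm) {y y' : unitInterval} (h : y ≤ y') :
    ⌈(σ.length : ℝ) * y⌉₊ ≤ ⌈(σ.length : ℝ) * y'⌉₊ :=
  Nat.ceil_mono (mul_le_mul_of_nonneg_left h (Nat.cast_nonneg _))

theorem stepValue_mono (σ : FinPerm) (x : unitInterval) : Monotone (σ.stepValue x) := by
  intro y y' h
  by_cases hy : y = 0
  · have h0 : σ.stepValue x y = 0 := by simp [stepValue, hy]
    rw [h0]
    exact σ.stepValue_nonneg x y'
  have hy' : y' ≠ 0 := by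
    rintro rfl
    exact hy (le_antisymm h y.2.1)
  have hc := σ.ceil_mono h
  by_cases hx : x = 0
  · simp only [stepValue, hy, hy', hx, if_true, if_false]
    exact div_le_div_of_nonneg_right (Nat.cast_le.2 hc) (Nat.cast_nonneg _)
  · simp only [stepValue, hy, hy', hx, if_false, adjMatrix]
    have hcell : σ.cell y ≤ σ.cell y' := by
      simp only [cell, Fin.mk_le_mk]
      omega
    split_ifs with h1 h2
    · exact le_rfl
    · exact absurd (lt_of_lt_of_le h1 hcell) h2
    · exact zero_le_one
    · exact le_rfl

theorem stepValue_left_cont (σ : FinPerm) (x y : unitInterval) :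
    ContinuousWithinAt (σ.stepValue x) (Set.Iic y) y := by
  by_cases hy : y = 0
  · subst hy
    have : Set.Iic (0 : unitInterval) = {0} := by
      ext z
      simp only [Set.mem_Iic, Set.mem_singleton_iff]
      exact ⟨fun h => le_antisymm h z.2.1, fun h => h.le⟩
    rw [this]
    exact continuousWithinAt_singleton
  have hn : (0 : ℝ) < σ.length := Nat.cast_pos.2 σ.length_pos
  have hypos : (0 : ℝ) < y := lt_of_le_of_ne y.2.1 (fun h => hy (Subtype.ext h.symm))
  have hcpos : 0 < ⌈(σ.length : ℝ) * y⌉₊ := Nat.ceil_pos.2 (mul_pos hn hypos)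
  have hlt : ((⌈(σ.length : ℝ) * y⌉₊ - 1 : ℕ) : ℝ) < σ.length * y :=
    Nat.lt_ceil.1 (by omega)
  have hcont : Continuous (fun z : unitInterval => (σ.length : ℝ) * z) := by fun_prop
  have ev : ∀ᶠ z : unitInterval in 𝓝 y, ((⌈(σ.length : ℝ) * y⌉₊ - 1 : ℕ) : ℝ) < σ.length * (z : ℝ) :=
    hcont.continuousAt.eventually (lt_mem_nhds hlt)
  refine ContinuousWithinAt.congr_of_eventuallyEq (f := fun _ => σ.stepValue x y)
    continuousWithinAt_const ?_ rfl
  filter_upwards [nhdsWithin_le_nhds ev, self_mem_nhdsWithin] with z hz hzy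
  have h1 := Nat.lt_ceil.2 hz
  have h2 := σ.ceil_mono (Set.mem_Iic.1 hzy)
  have hceq : ⌈(σ.length : ℝ) * z⌉₊ = ⌈(σ.length : ℝ) * y⌉₊ := by omega
  have hz0 : z ≠ 0 := by
    rintro rfl
    simp only [Set.Icc.coe_zero, mul_zero, Nat.ceil_zero] at hceq
    omega
  simp only [stepValue, hy, hz0, if_false, cell, hceq]

/-- The step function `Z_σ`, as a family of cdfs `Z_σ(x, ·)` indexed by `x ∈ [0,1]`. -/
noncomputable def stepFunction (σ : FinPerm) (x : unitInterval) : UnitCdf where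
  toFun := σ.stepValue x
  mono := σ.stepValue_mono x
  left_cont := σ.stepValue_left_cont x
  map_zero := by simp [stepValue]
  le_one := σ.stepValue_le_one x

/-- The rectangular distance between two permutations of arbitrary lengths. -/
noncomputable def rectDist (σ π : FinPerm) : ℝ :=
  cdfRectDist σ.stepFunction π.stepFunction

/-- A permutation sequence is Cauchy with respect to the rectangular distance. -/
def RectCauchy (σ : ℕ → FinPerm) : Prop :=
  ∀ ε : ℝ, 0 < ε → ∃ n₀ : ℕ, ∀ n m : ℕ, n₀ ≤ n → n₀ ≤ m → rectDist (σ n) (σ m) < ε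

end FinPerm

/-! Suppose first that the lengths tend to infinity. Both notions are compared with pointwise
convergence on the unit square of the cumulative function F(x, y), the fraction of points (a, σ a)/n
of the graph with a/n < x and σ a/n < y (`cumulative`). For x ≠ 0 the measure of Z_σ(x, ·) is a
point mass, so a rectangle has mass equal to the second difference of F up to 8/n
(`abs_boxMass_sub_cumulative_le`). As F is Lipschitz up to O(1/n), pointwise convergence is uniform,
and it amounts to being Cauchy for the rectangular distance.

From densities to F: the moment of (a/n)^p (σ a/n)^q counts tuples with p entries to the left of a
base point and q entries below it (`graphAverage_pow_eq`). This depends only on order types once the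
few non-injective tuples are discarded, so moments converge. Weierstrass approximation of step
functions then gives convergence of F.

From F to densities: cut the square into an M × M grid. Except for tuples with two entries in a
common row or column of the grid, the order type is read off from the cells. Hence a normalised
pattern count is, up to O(1/M + 1/n), a polynomial in the cell masses (`abs_occurrences_sub_le`),
which are second differences of F.

If the lengths do not tend to infinity, either condition forces the sequence to be eventually
constant. For densities, some π recurs by pigeonhole and its densities are the limits; for the
distance, every permutation is an isolated point (`le_rectDist_of_ne`). An eventually constant
sequence satisfies both conditions. -/

/-! ### Order types of tuples -/

/-- Two tuples are order isomorphic. -/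
def SameOrder {ι A B : Type*} [LT A] [LT B] (u : ι → A) (v : ι → B) : Prop :=
  ∀ i j, u i < u j ↔ v i < v j

namespace SameOrder

theorem symm {ι A B : Type*} [LT A] [LT B] {u : ι → A} {v : ι → B} (h : SameOrder u v) :
    SameOrder v u := fun i j => (h i j).symm

theorem trans {ι A B C : Type*} [LT A] [LT B] [LT C] {u : ι → A} {v : ι → B} {w : ι → C}
    (h : SameOrder u v) (h' : SameOrder v w) : SameOrder u w :=
  fun i j => (h i j).trans (h' i j)

theorem injective {ι A B : Type*} [LinearOrder A] [LinearOrder B] {u : ι → A} {v : ι → B}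
    (h : SameOrder u v) (hv : Function.Injective v) : Function.Injective u := by
  intro i j hij
  apply hv
  apply le_antisymm
  · exact not_lt.1 fun hlt => absurd ((h j i).2 hlt) (by simp [hij])
  · exact not_lt.1 fun hlt => absurd ((h i j).2 hlt) (by simp [hij])

/-- The inverse of the sorting permutation sends each index to the rank of its entry. -/
theorem exists_perm {k : ℕ} {A : Type*} [LinearOrder A] (u : Fin k → A)
    (hu : Function.Injective u) : ∃ α : Equiv.Perm (Fin k), SameOrder u α := by
  have hs : StrictMono (u ∘ Tuple.sort u) :=
    (Tuple.monotone_sort u).strictMono_of_injective (hu.comp (Equiv.injective _))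
  refine ⟨(Tuple.sort u)⁻¹, fun i j => ?_⟩
  have := hs.lt_iff_lt (a := (Tuple.sort u)⁻¹ i) (b := (Tuple.sort u)⁻¹ j)
  simpa using this

/-- The quotient α β⁻¹ is a monotone permutation of a finite chain, hence the identity. -/
theorem perm_eq {k : ℕ} {α β : Equiv.Perm (Fin k)} (h : SameOrder α β) : α = β := by
  have hm : Monotone (α * β⁻¹ : Equiv.Perm (Fin k)) := by
    refine StrictMono.monotone fun i j hij => ?_
    have := h (β⁻¹ i) (β⁻¹ j)
    simp only [← Equiv.Perm.mul_apply, mul_inv_cancel] at this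
    exact this.2 hij
  exact mul_inv_eq_one.1 ((Equiv.Perm.monotone_iff _).1 hm)

end SameOrder

/-! ### Counting tuples by order type -/

/-- Precomposing z with α⁻¹ sorts the positions and turns the order type β of the values into β α⁻¹.
-/
theorem ncard_sameOrder_eq_occurrences {k n : ℕ} (σ : Equiv.Perm (Fin n)) (α β : Equiv.Perm (Fin k))
    (hk : 0 < k) (hn : 0 < n) :
    Set.ncard {z : Fin k → Fin n | SameOrder z α ∧ SameOrder (σ ∘ z) β} =
      FinPerm.occurrences ⟨k, hk, β * α⁻¹⟩ ⟨n, hn, σ⟩ := by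
  unfold FinPerm.occurrences
  refine Set.ncard_congr (fun z _ => z ∘ (α⁻¹ : Equiv.Perm (Fin k))) ?_ ?_ ?_
  · rintro z ⟨h1, h2⟩
    refine ⟨fun i j hij => (h1 _ _).2 (by simpa using hij), fun i j => ?_⟩
    simpa using h2 (α⁻¹ i) (α⁻¹ j)
  · intro z w _ _ h
    ext i
    have := congrFun h (α i)
    simp at this
    rw [this]
  · rintro x ⟨h1, h2⟩
    refine ⟨x ∘ α, ⟨fun i j => h1.lt_iff_lt, fun i j => ?_⟩, ?_⟩
    · simpa using h2 (α i) (α j)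
    · ext i
      simp

open Classical in
/-- The tuples satisfying a property that only depends on the order type of injective tuples are
counted, up to the non-injective ones, by pattern occurrences. -/
theorem card_filter_injective_eq_sum_occurrences {k n : ℕ} (σ : Equiv.Perm (Fin n)) (hk : 0 < k)
    (hn : 0 < n) (R : (Fin k → Fin n) → Prop)
    (Good : Equiv.Perm (Fin k) × Equiv.Perm (Fin k) → Prop)
    (hR : ∀ (z : Fin k → Fin n) (α β : Equiv.Perm (Fin k)), SameOrder z α → SameOrder (σ ∘ z) β →
      (R z ↔ Good (α, β))) :
    Finset.card {z : Fin k → Fin n | R z ∧ Function.Injective z} =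
      ∑ p : Equiv.Perm (Fin k) × Equiv.Perm (Fin k) with Good p,
        FinPerm.occurrences ⟨k, hk, p.2 * p.1⁻¹⟩ ⟨n, hn, σ⟩ := by
  -- An injective tuple has exactly one pair of order types, of positions and of values, so the
  -- union is disjoint.
  have hu : (Finset.univ.filter fun z : Fin k → Fin n => R z ∧ Function.Injective z) =
      (Finset.univ.filter fun p => Good p).biUnion fun p =>
        Finset.univ.filter fun z : Fin k → Fin n => SameOrder z p.1 ∧ SameOrder (σ ∘ z) p.2 := by
    ext z
    simp only [Finset.mem_filter, Finset.mem_univ, true_and, Finset.mem_biUnion, Prod.exists]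
    constructor
    · rintro ⟨h1, h2⟩
      obtain ⟨α, hα⟩ := SameOrder.exists_perm z h2
      obtain ⟨β, hβ⟩ := SameOrder.exists_perm (σ ∘ z) (σ.injective.comp h2)
      exact ⟨α, β, (hR z α β hα hβ).1 h1, hα, hβ⟩
    · rintro ⟨α, β, hg, hα, hβ⟩
      exact ⟨(hR z α β hα hβ).2 hg, hα.injective α.injective⟩
  rw [hu, Finset.card_biUnion]
  · refine Finset.sum_congr rfl fun p _ => ?_
    rw [← ncard_sameOrder_eq_occurrences, ← Set.ncard_coe_finset]
    simp
  · intro p _ q _ hpq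
    rw [Function.onFun, Finset.disjoint_left]
    intro z hz hz'
    simp only [Finset.mem_filter, Finset.mem_univ, true_and] at hz hz'
    exact hpq (Prod.ext (hz.1.symm.trans hz'.1).perm_eq (hz.2.symm.trans hz'.2).perm_eq)

/-- The number of tuples in which two prescribed entries are related by a relation all of whose
rows are small. -/
theorem card_filter_rel_le {k n : ℕ} (i j : Fin k) (hij : i ≠ j)
    (r : Fin n → Fin n → Prop) [DecidableRel r] (B : ℕ)
    (hB : ∀ a, Finset.card {b : Fin n | r a b} ≤ B) :
    Finset.card {z : Fin k → Fin n | r (z i) (z j)} ≤ B * n ^ (k - 1) := by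
  obtain ⟨k, rfl⟩ : ∃ m, k = m + 1 := ⟨k - 1, by have := i.pos; omega⟩
  obtain ⟨i, rfl⟩ := Fin.exists_succAbove_eq hij
  -- Delete the entry at j: the others are free, and the relation leaves at most B choices for the
  -- deleted one.
  have : Finset.card {z : Fin (k + 1) → Fin n | r (z (j.succAbove i)) (z j)} =
      Finset.card (Finset.univ.sigma fun w : Fin k → Fin n =>
        Finset.univ.filter fun b => r (w i) b) := by
    refine Finset.card_bij' (fun z _ => ⟨fun t => z (j.succAbove t), z j⟩)
      (fun w _ => Fin.insertNth j w.2 w.1) ?_ ?_ ?_ ?_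
    · intro z hz
      simpa using hz
    · intro w hw
      simpa using hw
    · intro z _
      exact Fin.insertNth_self_removeNth j z
    · intro w _
      simp
  rw [this, Finset.card_sigma]
  calc _ ≤ ∑ _w : Fin k → Fin n, B := Finset.sum_le_sum fun w _ => hB _
    _ = B * n ^ (k + 1 - 1) := by simp [mul_comm]

/-- The number of tuples in which two different entries are related. -/
theorem card_filter_exists_rel_le {k n : ℕ} (r : Fin n → Fin n → Prop) [DecidableRel r] (B : ℕ)
    (hB : ∀ a, Finset.card {b : Fin n | r a b} ≤ B) :
    Finset.card {z : Fin k → Fin n | ∃ i j, i ≠ j ∧ r (z i) (z j)} ≤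
      k ^ 2 * (B * n ^ (k - 1)) := by
  have hsub : (Finset.univ.filter fun z : Fin k → Fin n => ∃ i j, i ≠ j ∧ r (z i) (z j)) ⊆
      (Finset.univ.filter fun p : Fin k × Fin k => p.1 ≠ p.2).biUnion fun p =>
        Finset.univ.filter fun z : Fin k → Fin n => r (z p.1) (z p.2) := by
    intro z hz
    simp only [Finset.mem_filter, Finset.mem_univ, true_and, Finset.mem_biUnion,
      Prod.exists] at hz ⊢
    obtain ⟨i, j, h, h'⟩ := hz
    exact ⟨i, j, h, h'⟩
  refine (Finset.card_le_card hsub).trans (Finset.card_biUnion_le.trans ?_)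
  calc _ ≤ ∑ _p : Fin k × Fin k with _p.1 ≠ _p.2, B * n ^ (k - 1) :=
        Finset.sum_le_sum fun p hp => card_filter_rel_le _ _ (by simpa using hp) r B hB
    _ ≤ k ^ 2 * (B * n ^ (k - 1)) := by
        rw [Finset.sum_const, smul_eq_mul]
        gcongr
        exact (Finset.card_filter_le _ _).trans (by simp [sq])

theorem card_filter_not_injective_le (k n : ℕ) :
    Finset.card {z : Fin k → Fin n | ¬ Function.Injective z} ≤ k ^ 2 * n ^ (k - 1) := by
  have := card_filter_exists_rel_le (k := k) (n := n) (fun a b => a = b) 1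
    (fun a => by simp [Finset.filter_eq])
  rw [one_mul] at this
  refine le_trans (Finset.card_le_card fun z hz => ?_) this
  simp only [Finset.mem_filter, Finset.mem_univ, true_and, Function.Injective, not_forall] at hz ⊢
  obtain ⟨i, j, h, h'⟩ := hz
  exact ⟨i, j, h', h⟩

/-! ### Densities and normalised pattern counts -/

open FinPerm

theorem occurrences_eq_density_mul_choose (τ π : FinPerm) (h : τ.length ≤ π.length) :
    (occurrences τ π : ℝ) = density τ π * (π.length.choose τ.length) := by
  have : ((π.length.choose τ.length : ℕ) : ℝ) ≠ 0 :=
    Nat.cast_ne_zero.2 (Nat.choose_pos h).ne'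
  rw [density, if_pos h]
  field_simp

/-- Each k-subset of positions, listed increasingly, is an occurrence of some pattern of length k.
-/
theorem choose_le_sum_occurrences (π : FinPerm) (k : ℕ) (hk : 0 < k) :
    π.length.choose k ≤ ∑ τ : Equiv.Perm (Fin k), occurrences ⟨k, hk, τ⟩ π := by
  classical
  have h1 : π.length.choose k ≤
      Finset.card {x : Fin k → Fin π.length | StrictMono x} := by
    have : π.length.choose k = ((Finset.univ : Finset (Fin π.length)).powersetCard k).card := by
      simp
    rw [this]
    refine Finset.card_le_card_of_injOn
      (fun s => if h : s.card = k then s.orderEmbOfFin h else fun _ => ⟨0, π.length_pos⟩) ?_ ?_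
    · intro s hs
      have hs' : s.card = k := by simpa using hs
      simp [hs', OrderEmbedding.strictMono]
    · intro s hs t ht hst
      have hs' : s.card = k := by simpa using hs
      have ht' : t.card = k := by simpa using ht
      simp only [hs', ht', dif_pos] at hst
      have := congrArg Set.range hst
      rwa [Finset.range_orderEmbOfFin, Finset.range_orderEmbOfFin, Finset.coe_inj] at this
  refine h1.trans ?_
  have h2 : (Finset.univ.filter fun x : Fin k → Fin π.length => StrictMono x) ⊆
      Finset.univ.biUnion fun τ : Equiv.Perm (Fin k) => Finset.univ.filter fun x =>
        StrictMono x ∧ ∀ i j, π.perm (x i) < π.perm (x j) ↔ τ i < τ j := by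
    intro x hx
    simp only [Finset.mem_filter, Finset.mem_univ, true_and, Finset.mem_biUnion] at hx ⊢
    obtain ⟨τ, hτ⟩ := SameOrder.exists_perm (π.perm ∘ x) (π.perm.injective.comp hx.injective)
    exact ⟨τ, hx, hτ⟩
  refine (Finset.card_le_card h2).trans (Finset.card_biUnion_le.trans (Finset.sum_le_sum ?_))
  intro τ _
  rw [occurrences, ← Set.ncard_coe_finset]
  simp

theorem one_le_sum_density (π : FinPerm) (k : ℕ) (hk : 0 < k) (h : k ≤ π.length) :
    1 ≤ ∑ τ : Equiv.Perm (Fin k), density ⟨k, hk, τ⟩ π := by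
  have hc : (0 : ℝ) < π.length.choose k := Nat.cast_pos.2 (Nat.choose_pos h)
  simp only [density, h, if_true]
  rw [← Finset.sum_div, le_div_iff₀ hc, one_mul]
  exact_mod_cast choose_le_sum_occurrences π k hk

theorem density_self_pos (π : FinPerm) : 0 < density π π := by
  rw [density, if_pos le_rfl, Nat.choose_self, Nat.cast_one, div_one, Nat.cast_pos, occurrences,
    Set.ncard_pos (Set.toFinite _)]
  exact ⟨id, strictMono_id, fun _ _ => Iff.rfl⟩

/-- A pattern that occurs is no longer than π, so the lengths agree, and the only increasing
self-map of a finite chain is the identity. -/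
theorem eq_of_density_pos {τ π : FinPerm} (h : 0 < density τ π) (hl : π.length ≤ τ.length) :
    τ = π := by
  have hle : τ.length ≤ π.length := by
    by_contra hc
    simp [density, hc] at h
  obtain ⟨k, hk, τ⟩ := τ
  obtain ⟨n, hn, π⟩ := π
  obtain rfl : k = n := le_antisymm hle hl
  rw [density, if_pos le_rfl] at h
  have hpos : occurrences ⟨k, hk, τ⟩ ⟨k, hk, π⟩ ≠ 0 := by
    intro h0
    simp [h0] at h
  obtain ⟨x, hx, hx'⟩ := Set.nonempty_of_ncard_ne_zero hpos
  have hid : x = id := by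
    have hb : Function.Bijective x := Finite.injective_iff_bijective.1 hx.injective
    have := (Equiv.Perm.monotone_iff (Equiv.ofBijective x hb)).1 (by simpa using hx.monotone)
    ext i
    have := congrArg (fun e => e i) this
    simp at this
    simp [this]
  subst hid
  have : SameOrder π τ := hx'
  rw [this.perm_eq]

theorem tendsto_choose_div_pow (k : ℕ) :
    Tendsto (fun n : ℕ => (n.choose k : ℝ) / (n : ℝ) ^ k) atTop (𝓝 (1 / k.factorial)) := by
  have h : Tendsto (fun n : ℕ => (n : ℝ) * (n : ℝ)⁻¹) atTop (𝓝 1) := by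
    refine tendsto_const_nhds.congr' ?_
    filter_upwards [eventually_gt_atTop 0] with n hn
    have : (n : ℝ) ≠ 0 := by positivity
    field_simp
  have := ProbabilityTheory.tendsto_choose_mul_pow_atTop k h
  simpa [div_eq_mul_inv] using this

/-- Along permutations of growing length, the convergence of a density is the convergence of the
normalised number of occurrences. -/
theorem tendsto_density_iff {σ : ℕ → FinPerm} (hσ : Tendsto (fun n => (σ n).length) atTop atTop)
    (τ : FinPerm) :
    (∃ l : ℝ, Tendsto (fun n => density τ (σ n)) atTop (𝓝 l)) ↔
      ∃ l : ℝ, Tendsto (fun n => (occurrences τ (σ n) : ℝ) / ((σ n).length : ℝ) ^ τ.length)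
        atTop (𝓝 l) := by
  have hc := (tendsto_choose_div_pow τ.length).comp hσ
  have hlen := hσ.eventually_ge_atTop τ.length
  constructor
  · rintro ⟨l, hl⟩
    refine ⟨_, (hl.mul hc).congr' ?_⟩
    filter_upwards [hlen] with n hn
    rw [occurrences_eq_density_mul_choose _ _ hn]
    simp only [Function.comp]
    ring
  · rintro ⟨l, hl⟩
    refine ⟨_, (hl.div hc (by positivity)).congr' ?_⟩
    filter_upwards [hlen] with n hn
    have h1 : (((σ n).length.choose τ.length : ℕ) : ℝ) ≠ 0 :=
      Nat.cast_ne_zero.2 (Nat.choose_pos hn).ne'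
    have h2 : ((σ n).length : ℝ) ≠ 0 := Nat.cast_ne_zero.2 (σ n).length_pos.ne'
    simp only [Pi.div_apply, Function.comp]
    rw [occurrences_eq_density_mul_choose _ _ hn]
    field_simp

/-! ### Calculus of convergent real sequences -/

/-- A real sequence has a limit. -/
def HasLimit (u : ℕ → ℝ) : Prop := ∃ l : ℝ, Tendsto u atTop (𝓝 l)

namespace HasLimit

theorem const (c : ℝ) : HasLimit fun _ => c := ⟨c, tendsto_const_nhds⟩

theorem add {u v : ℕ → ℝ} (hu : HasLimit u) (hv : HasLimit v) : HasLimit fun n => u n + v n :=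
  let ⟨_, hl⟩ := hu; let ⟨_, hm⟩ := hv; ⟨_, hl.add hm⟩

theorem sub {u v : ℕ → ℝ} (hu : HasLimit u) (hv : HasLimit v) : HasLimit fun n => u n - v n :=
  let ⟨_, hl⟩ := hu; let ⟨_, hm⟩ := hv; ⟨_, hl.sub hm⟩

theorem const_mul (c : ℝ) {u : ℕ → ℝ} (hu : HasLimit u) : HasLimit fun n => c * u n :=
  let ⟨_, hl⟩ := hu; ⟨_, hl.const_mul c⟩

theorem sum {ι : Type*} (s : Finset ι) {u : ι → ℕ → ℝ} (hu : ∀ i ∈ s, HasLimit (u i)) :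
    HasLimit fun n => ∑ i ∈ s, u i n := by
  choose! l hl using hu
  exact ⟨_, tendsto_finsetSum s hl⟩

theorem prod {ι : Type*} (s : Finset ι) {u : ι → ℕ → ℝ} (hu : ∀ i ∈ s, HasLimit (u i)) :
    HasLimit fun n => ∏ i ∈ s, u i n := by
  choose! l hl using hu
  exact ⟨_, tendsto_finsetProd s hl⟩

theorem iff_cauchy {u : ℕ → ℝ} : HasLimit u ↔ ∀ ε > 0, ∃ N, ∀ m ≥ N, ∀ n ≥ N, |u m - u n| < ε := by
  have : HasLimit u ↔ CauchySeq u := ⟨fun ⟨_, h⟩ => h.cauchySeq, cauchySeq_tendsto_of_complete⟩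
  rw [this, Metric.cauchySeq_iff]
  rfl

/-- A sequence that is eventually uniformly close to convergent sequences converges. -/
theorem of_approx {v : ℕ → ℝ}
    (h : ∀ ε > 0, ∃ u, HasLimit u ∧ ∀ᶠ n in atTop, |v n - u n| ≤ ε) : HasLimit v := by
  rw [iff_cauchy]
  intro ε hε
  obtain ⟨u, hu, hvu⟩ := h (ε / 4) (by positivity)
  obtain ⟨N, hN⟩ := iff_cauchy.1 hu (ε / 4) (by positivity)
  obtain ⟨N', hN'⟩ := eventually_atTop.1 hvu
  refine ⟨max N N', fun m hm n hn => ?_⟩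
  have h1 := abs_le.1 (hN' m (le_of_max_le_right hm))
  have h2 := abs_le.1 (hN' n (le_of_max_le_right hn))
  have h3 := abs_lt.1 (hN m (le_of_max_le_left hm) n (le_of_max_le_left hn))
  rw [abs_lt]
  constructor <;> linarith [h1.1, h1.2, h2.1, h2.2, h3.1, h3.2]

end HasLimit

/-! ### Averages over grid points and over graphs -/

theorem card_filter_le_of_mem_Icc {n : ℕ} (P : Fin n → Prop) [DecidablePred P] {x y : ℝ}
    (hxy : x ≤ y) (h : ∀ a, P a → x ≤ (a : ℝ) / n ∧ (a : ℝ) / n ≤ y) :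
    (Finset.card {a | P a} : ℝ) ≤ n * (y - x) + 1 := by
  rcases Nat.eq_zero_or_pos n with rfl | hn
  · simp
  have hn' : (0 : ℝ) < n := Nat.cast_pos.2 hn
  have hc : Finset.card {a | P a} ≤ (Finset.Icc ⌈n * x⌉ ⌊n * y⌋).card := by
    refine Finset.card_le_card_of_injOn (fun a => ((a : ℕ) : ℤ)) ?_ ?_
    · intro a ha
      have ha' : P a := by simpa using ha
      obtain ⟨h1, h2⟩ := h a ha'
      rw [le_div_iff₀ hn'] at h1
      rw [div_le_iff₀ hn'] at h2
      simp only [Finset.coe_Icc, Set.mem_Icc, Int.ceil_le, Int.le_floor]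
      push_cast
      constructor <;> linarith
    · intro a _ b _ hab
      exact Fin.ext (by simpa using hab)
  rw [Int.card_Icc] at hc
  have h0 : (0 : ℝ) ≤ n * (y - x) := mul_nonneg hn'.le (by linarith)
  have h1 := Int.le_ceil (n * x)
  have h2 := Int.floor_le (n * y)
  have h3 : ((⌊n * y⌋ + 1 - ⌈n * x⌉).toNat : ℝ) ≤ n * (y - x) + 1 := by
    rcases le_total 0 (⌊n * y⌋ + 1 - ⌈n * x⌉) with h4 | h4
    · have : ((⌊n * y⌋ + 1 - ⌈n * x⌉).toNat : ℝ) = ((⌊n * y⌋ + 1 - ⌈n * x⌉ : ℤ) : ℝ) := by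
        exact_mod_cast Int.toNat_of_nonneg h4
      rw [this]
      push_cast
      linarith
    · rw [Int.toNat_of_nonpos h4]
      simp only [Nat.cast_zero]
      linarith
  exact (Nat.cast_le.2 hc).trans h3

/-- The average of `h` over the points `a / n`. -/
noncomputable def gridAverage (n : ℕ) (h : ℝ → ℝ) : ℝ :=
  (∑ a : Fin n, h ((a : ℝ) / n)) / n

/-- Meant for an error function h that is uniformly small except on a short interval around a jump.
-/
theorem gridAverage_le_of_support {n : ℕ} (hn : 0 < n) {h : ℝ → ℝ} {x y c : ℝ} (hxy : x ≤ y)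
    (h1 : ∀ t, 0 ≤ t → t ≤ 1 → h t ≤ 1 + c)
    (h0 : ∀ t, 0 ≤ t → t ≤ 1 → ¬ (x ≤ t ∧ t ≤ y) → h t ≤ c) :
    gridAverage n h ≤ (y - x) + 1 / n + c := by
  classical
  have hn' : (0 : ℝ) < n := Nat.cast_pos.2 hn
  have hcard := card_filter_le_of_mem_Icc
    (fun a : Fin n => x ≤ (a : ℝ) / n ∧ (a : ℝ) / n ≤ y) hxy (fun a h => h)
  have hsum : ∑ a : Fin n, h ((a : ℝ) / n) ≤
      ∑ a : Fin n, ((if x ≤ (a : ℝ) / n ∧ (a : ℝ) / n ≤ y then 1 else 0) + c) := by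
    refine Finset.sum_le_sum fun a _ => ?_
    have ha0 : 0 ≤ (a : ℝ) / n := by positivity
    have ha1 : (a : ℝ) / n ≤ 1 := div_le_one_of_le₀ (Nat.cast_le.2 a.2.le) hn'.le
    split_ifs with hs
    · exact h1 _ ha0 ha1
    · simpa using h0 _ ha0 ha1 hs
  rw [Finset.sum_add_distrib, Finset.sum_boole] at hsum
  simp only [Finset.sum_const, Finset.card_univ, Fintype.card_fin, nsmul_eq_mul] at hsum
  rw [gridAverage, div_le_iff₀ hn']
  have : ((y - x) + 1 / n + c) * n = n * (y - x) + 1 + n * c := by field_simp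
  linarith

namespace FinPerm

/-- The average of `f ⊗ g` over the points `(a, σ a) / n` of the graph of `σ`. -/
noncomputable def graphAverage (σ : FinPerm) (f g : ℝ → ℝ) : ℝ :=
  (∑ a : Fin σ.length, f ((a : ℝ) / σ.length) * g ((σ.perm a : ℝ) / σ.length)) / σ.length

/-- Telescope the product; since σ is a bijection, averaging over the values σ a is averaging over
the grid. The bound 2 leaves room for the polynomial approximants of step functions. -/
theorem graphAverage_sub_le (σ : FinPerm) {f f' g g' : ℝ → ℝ}
    (hg : ∀ t, 0 ≤ t → t ≤ 1 → |g t| ≤ 1) (hf' : ∀ t, 0 ≤ t → t ≤ 1 → |f' t| ≤ 2) :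
    |σ.graphAverage f g - σ.graphAverage f' g'| ≤
      gridAverage σ.length (fun t => |f t - f' t|) +
        2 * gridAverage σ.length (fun t => |g t - g' t|) := by
  have hn' : (0 : ℝ) < σ.length := Nat.cast_pos.2 σ.length_pos
  have hperm : ∑ a : Fin σ.length, |g ((a : ℝ) / σ.length) - g' ((a : ℝ) / σ.length)| =
      ∑ a : Fin σ.length,
        |g ((σ.perm a : ℝ) / σ.length) - g' ((σ.perm a : ℝ) / σ.length)| :=
    (Equiv.sum_comp σ.perm fun a : Fin σ.length =>
      |g ((a : ℝ) / σ.length) - g' ((a : ℝ) / σ.length)|).symm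
  have hI : ∀ a : Fin σ.length, 0 ≤ (a : ℝ) / σ.length ∧ (a : ℝ) / σ.length ≤ 1 := fun a =>
    ⟨by positivity, div_le_one_of_le₀ (Nat.cast_le.2 a.2.le) hn'.le⟩
  rw [graphAverage, graphAverage, gridAverage, gridAverage, hperm, ← sub_div, ← mul_div_assoc,
    ← add_div, abs_div, abs_of_pos hn', ← Finset.sum_sub_distrib, Finset.mul_sum,
    ← Finset.sum_add_distrib]
  gcongr
  refine (Finset.abs_sum_le_sum_abs _ _).trans (Finset.sum_le_sum fun a _ => ?_)
  have h1 := hg _ (hI (σ.perm a)).1 (hI (σ.perm a)).2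
  have h2 := hf' _ (hI a).1 (hI a).2
  set x := f ((a : ℝ) / σ.length)
  set x' := f' ((a : ℝ) / σ.length)
  set y := g ((σ.perm a : ℝ) / σ.length)
  set y' := g' ((σ.perm a : ℝ) / σ.length)
  calc |x * y - x' * y'| = |(x - x') * y + x' * (y - y')| := by ring_nf
    _ ≤ |x - x'| * |y| + |x'| * |y - y'| := by
      rw [← abs_mul, ← abs_mul]; exact abs_add_le _ _
    _ ≤ |x - x'| * 1 + 2 * |y - y'| := by gcongr
    _ = _ := by ring

/-- With 0-based indices exactly a indices lie below a, so a^p (σ a)^q counts the choices of p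
positions before a and q positions with value below σ a. This turns moments into order-type
statistics, without error. -/
theorem graphAverage_pow_eq (σ : FinPerm) (p q : ℕ) :
    σ.graphAverage (fun t => t ^ p) (fun t => t ^ q) =
      (Finset.card {z : Fin (p + q + 1) → Fin σ.length |
        (∀ i : Fin p, z (Fin.castAdd q i).succ < z 0) ∧
        ∀ j : Fin q, σ.perm (z (Fin.natAdd p j).succ) < σ.perm (z 0)} : ℝ) /
          (σ.length : ℝ) ^ (p + q + 1) := by
  classical
  have hn' : (σ.length : ℝ) ≠ 0 := Nat.cast_ne_zero.2 σ.length_pos.ne'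
  have hlt : ∀ a : Fin σ.length, ∑ b : Fin σ.length, (if b < a then (1 : ℝ) else 0) = a := by
    intro a
    rw [Finset.sum_boole]
    have : (Finset.univ.filter fun b : Fin σ.length => b < a) = Finset.Iio a := by ext; simp
    rw [this, Fin.card_Iio]
  have key : (Finset.card {z : Fin (p + q + 1) → Fin σ.length |
        (∀ i : Fin p, z (Fin.castAdd q i).succ < z 0) ∧
        ∀ j : Fin q, σ.perm (z (Fin.natAdd p j).succ) < σ.perm (z 0)} : ℝ) =
      ∑ a : Fin σ.length, (a : ℝ) ^ p * (σ.perm a : ℝ) ^ q := by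
    -- Split z into its base point z 0, the next p entries and the last q entries.
    rw [← Finset.sum_boole, ← (Fin.consEquiv fun _ => Fin σ.length).sum_comp,
      Fintype.sum_prod_type]
    refine Finset.sum_congr rfl fun a _ => ?_
    rw [← (Fin.appendEquiv p q).sum_comp, Fintype.sum_prod_type]
    have h1 : (a : ℝ) ^ p = ∑ b : Fin p → Fin σ.length, ∏ i, if b i < a then (1 : ℝ) else 0 := by
      rw [← hlt a, Fintype.sum_pow]
    have h2 : (σ.perm a : ℝ) ^ q = ∑ c : Fin q → Fin σ.length, ∏ i,
        if σ.perm (c i) < σ.perm a then (1 : ℝ) else 0 := by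
      rw [← Fintype.sum_pow (f := fun c => if σ.perm c < σ.perm a then (1 : ℝ) else 0),
        Equiv.sum_comp σ.perm fun b => if b < σ.perm a then (1 : ℝ) else 0, hlt]
    rw [h1, h2, Finset.sum_mul_sum]
    refine Finset.sum_congr rfl fun b _ => Finset.sum_congr rfl fun c _ => ?_
    simp only [Finset.prod_boole, Fin.consEquiv, Fin.appendEquiv,
      Equiv.coe_fn_mk, Fin.cons_succ, Fin.cons_zero, Fin.append_left, Fin.append_right,
      Finset.mem_univ, true_implies]
    split_ifs <;> simp_all
  rw [key, graphAverage, eq_div_iff (pow_ne_zero _ hn'), div_mul_eq_mul_div, div_eq_iff hn',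
    Finset.sum_mul, Finset.sum_mul]
  refine Finset.sum_congr rfl fun a _ => ?_
  simp only [div_pow]
  field_simp
  ring

open Polynomial in
theorem graphAverage_polynomial (σ : FinPerm) (p q : ℝ[X]) :
    σ.graphAverage (fun t => p.eval t) (fun t => q.eval t) =
      ∑ i ∈ Finset.range (p.natDegree + 1), ∑ j ∈ Finset.range (q.natDegree + 1),
        (p.coeff i * q.coeff j) * σ.graphAverage (fun t => t ^ i) (fun t => t ^ j) := by
  have h : ∀ a b : ℝ, p.eval a * q.eval b =
      ∑ i ∈ Finset.range (p.natDegree + 1), ∑ j ∈ Finset.range (q.natDegree + 1),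
        (p.coeff i * q.coeff j) * (a ^ i * b ^ j) := by
    intro a b
    rw [eval_eq_sum_range, eval_eq_sum_range, Finset.sum_mul_sum]
    exact Finset.sum_congr rfl fun i _ => Finset.sum_congr rfl fun j _ => by ring
  simp only [graphAverage, h]
  rw [Finset.sum_comm, Finset.sum_div]
  refine Finset.sum_congr rfl fun i _ => ?_
  rw [Finset.sum_comm, Finset.sum_div]
  refine Finset.sum_congr rfl fun j _ => ?_
  rw [← Finset.mul_sum, mul_div_assoc]

end FinPerm

/-! ### From converging densities to converging cumulative masses -/

/-- Densities of properties of tuples determined by the order type converge. -/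
theorem hasLimit_card_filter {σ : ℕ → FinPerm} (hσ : Tendsto (fun n => (σ n).length) atTop atTop)
    (hc : Convergent σ) {k : ℕ} (hk : 0 < k) (R : ∀ n, (Fin k → Fin (σ n).length) → Prop)
    [∀ n, DecidablePred (R n)] (Good : Equiv.Perm (Fin k) × Equiv.Perm (Fin k) → Prop)
    (hR : ∀ n (z : Fin k → Fin (σ n).length) (α β : Equiv.Perm (Fin k)), SameOrder z α →
      SameOrder ((σ n).perm ∘ z) β → (R n z ↔ Good (α, β))) :
    HasLimit fun n => (Finset.card {z | R n z} : ℝ) / ((σ n).length : ℝ) ^ k := by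
  classical
  refine HasLimit.of_approx fun ε hε =>
    ⟨fun n => ∑ p : Equiv.Perm (Fin k) × Equiv.Perm (Fin k) with Good p,
      (occurrences ⟨k, hk, p.2 * p.1⁻¹⟩ (σ n) : ℝ) / ((σ n).length : ℝ) ^ k,
      HasLimit.sum _ fun p _ => (tendsto_density_iff hσ _).1 (hc _), ?_⟩
  -- The non-injective tuples make up a fraction of at most k²/n.
  have hlim : Tendsto (fun n => (k : ℝ) ^ 2 / ((σ n).length : ℝ)) atTop (𝓝 0) :=
    tendsto_const_nhds.div_atTop (tendsto_natCast_atTop_atTop.comp hσ)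
  filter_upwards [hlim.eventually (gt_mem_nhds hε)] with n hn
  have hn' : (0 : ℝ) < (σ n).length := Nat.cast_pos.2 (σ n).length_pos
  have h1 : Finset.card {z : Fin k → Fin (σ n).length | R n z ∧ Function.Injective z} =
      ∑ p : Equiv.Perm (Fin k) × Equiv.Perm (Fin k) with Good p,
        occurrences ⟨k, hk, p.2 * p.1⁻¹⟩ (σ n) := by
    convert card_filter_injective_eq_sum_occurrences (σ n).perm hk (σ n).length_pos (R n) Good (hR n)
  have h2 : Finset.card {z | R n z} =
      Finset.card {z : Fin k → Fin (σ n).length | R n z ∧ Function.Injective z} +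
      Finset.card {z : Fin k → Fin (σ n).length | R n z ∧ ¬ Function.Injective z} := by
    rw [← Finset.filter_filter, ← Finset.filter_filter, Finset.card_filter_add_card_filter_not]
  have h3 : Finset.card {z : Fin k → Fin (σ n).length | R n z ∧ ¬ Function.Injective z} ≤
      k ^ 2 * (σ n).length ^ (k - 1) :=
    (Finset.card_le_card fun z hz => by simp_all).trans (card_filter_not_injective_le k _)
  rw [← Finset.sum_div, ← sub_div, h2, h1]
  push_cast
  rw [add_sub_cancel_left, abs_of_nonneg (by positivity)]
  refine le_trans ?_ hn.le
  rw [div_le_div_iff₀ (by positivity) hn']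
  have h4 : (σ n).length ^ k = (σ n).length ^ (k - 1) * (σ n).length := by
    rw [← pow_succ, Nat.sub_add_cancel hk]
  calc _ ≤ ((k ^ 2 * (σ n).length ^ (k - 1) : ℕ) : ℝ) * (σ n).length := by gcongr
    _ = (k : ℝ) ^ 2 * ((σ n).length : ℝ) ^ k := by
      rw [← Nat.cast_pow (σ n).length, h4]; push_cast; ring

theorem hasLimit_graphAverage_pow {σ : ℕ → FinPerm}
    (hσ : Tendsto (fun n => (σ n).length) atTop atTop) (hc : Convergent σ) (p q : ℕ) :
    HasLimit fun n => (σ n).graphAverage (fun t => t ^ p) (fun t => t ^ q) := by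
  simp only [graphAverage_pow_eq]
  refine hasLimit_card_filter hσ hc (Nat.succ_pos _) _
    (fun r => (∀ i : Fin p, r.1 (Fin.castAdd q i).succ < r.1 0) ∧
      ∀ j : Fin q, r.2 (Fin.natAdd p j).succ < r.2 0) ?_
  intro n z α β hα hβ
  exact and_congr (forall_congr' fun i => hα _ _) (forall_congr' fun j => hβ _ _)

open Polynomial in
theorem hasLimit_graphAverage_polynomial {σ : ℕ → FinPerm}
    (hσ : Tendsto (fun n => (σ n).length) atTop atTop) (hc : Convergent σ) (p q : ℝ[X]) :
    HasLimit fun n => (σ n).graphAverage (fun t => p.eval t) (fun t => q.eval t) := by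
  simp only [graphAverage_polynomial]
  exact HasLimit.sum _ fun i _ => HasLimit.sum _ fun j _ =>
    (hasLimit_graphAverage_pow hσ hc i j).const_mul _

open Polynomial in
/-- A step function is approximated by polynomials away from the jump. -/
theorem exists_polynomial_near_step (s : ℝ) {δ : ℝ} (hδ : 0 < δ) (hδ1 : δ ≤ 1) :
    ∃ p : ℝ[X], (∀ t, 0 ≤ t → t ≤ 1 → |p.eval t| ≤ 2) ∧
      (∀ t, 0 ≤ t → t ≤ 1 → |(if t < s then (1 : ℝ) else 0) - p.eval t| ≤ 1 + δ) ∧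
      ∀ t, 0 ≤ t → t ≤ 1 → ¬ (s ≤ t ∧ t ≤ s + δ) →
        |(if t < s then (1 : ℝ) else 0) - p.eval t| ≤ δ := by
  -- A continuous ramp, equal to the step outside [s, s + δ]; Weierstrass replaces it by a
  -- polynomial within δ on [0, 1].
  set f : ℝ → ℝ := fun t => max 0 (min 1 ((s + δ - t) / δ)) with hf
  have hfc : Continuous f := by fun_prop
  obtain ⟨p, hp⟩ := exists_polynomial_near_of_continuousOn 0 1 f hfc.continuousOn δ hδ
  have hf0 : ∀ t, 0 ≤ f t := fun t => le_max_left _ _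
  have hf1 : ∀ t, f t ≤ 1 := fun t => max_le zero_le_one (min_le_left _ _)
  have hp' : ∀ t, 0 ≤ t → t ≤ 1 → -δ < p.eval t - f t ∧ p.eval t - f t < δ := fun t h0 h1 =>
    abs_lt.1 (hp t ⟨h0, h1⟩)
  refine ⟨p, fun t h0 h1 => ?_, fun t h0 h1 => ?_, fun t h0 h1 h => ?_⟩
  · have := hp' t h0 h1
    have := hf0 t
    have := hf1 t
    rw [abs_le]; constructor <;> linarith
  · have := hp' t h0 h1
    have := hf0 t
    have := hf1 t
    rw [abs_le]; split_ifs <;> constructor <;> linarith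
  · have := hp' t h0 h1
    have hval : f t = if t < s then 1 else 0 := by
      split_ifs with hs
      · have : 1 ≤ (s + δ - t) / δ := by rw [le_div_iff₀ hδ]; linarith
        simp [hf, min_eq_left this]
      · have hts : s + δ < t := by
          by_contra hcon
          exact h ⟨not_lt.1 hs, not_lt.1 hcon⟩
        have : (s + δ - t) / δ ≤ 0 := div_nonpos_of_nonpos_of_nonneg (by linarith) hδ.le
        simp only [hf]
        exact max_eq_left ((min_le_right _ _).trans this)
    rw [← hval, abs_le]; constructor <;> linarith

/-- The indicator function of `(-∞, s)`. -/
noncomputable def stepBelow (s t : ℝ) : ℝ := if t < s then 1 else 0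

theorem hasLimit_graphAverage_step {σ : ℕ → FinPerm}
    (hσ : Tendsto (fun n => (σ n).length) atTop atTop) (hc : Convergent σ) (x y : ℝ) :
    HasLimit fun n => (σ n).graphAverage (stepBelow x) (stepBelow y) := by
  refine HasLimit.of_approx fun ε hε => ?_
  -- Each grid average of the error is at most δ + 1/n + δ < 3δ, and they enter with weights 1 and
  -- 2: in total 9δ.
  set δ := min 1 (ε / 9) with hδdef
  have hδ : 0 < δ := by positivity
  have hδ1 : δ ≤ 1 := min_le_left _ _
  have hδ2 : δ ≤ ε / 9 := min_le_right _ _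
  obtain ⟨p, hp2, hp1, hp0⟩ := exists_polynomial_near_step x hδ hδ1
  obtain ⟨q, hq2, hq1, hq0⟩ := exists_polynomial_near_step y hδ hδ1
  refine ⟨_, hasLimit_graphAverage_polynomial hσ hc p q, ?_⟩
  have hlim : Tendsto (fun n => (1 : ℝ) / ((σ n).length : ℝ)) atTop (𝓝 0) :=
    tendsto_const_nhds.div_atTop (tendsto_natCast_atTop_atTop.comp hσ)
  filter_upwards [hlim.eventually (gt_mem_nhds hδ)] with n hn
  have h1 := gridAverage_le_of_support (σ n).length_pos (by linarith : x ≤ x + δ) hp1 hp0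
  have h2 := gridAverage_le_of_support (σ n).length_pos (by linarith : y ≤ y + δ) hq1 hq0
  have h3 := (σ n).graphAverage_sub_le (f := stepBelow x) (f' := fun t => p.eval t)
    (g := stepBelow y) (g' := fun t => q.eval t)
    (fun t _ _ => by unfold stepBelow; split_ifs <;> simp) hp2
  unfold stepBelow at *
  linarith

/-! ### Masses of rectangles under the step function -/

/-- The measure is a Dirac mass at h: the Stieltjes function takes right limits, which turns `h < y`
into `h ≤ y`. -/
theorem UnitCdf.measureReal_Icc_of_extend {F : UnitCdf} {h : ℝ}
    (hF : ∀ y, F.extend y = if h < y then 1 else 0) (a b : ℝ) :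
    F.measure.real (Set.Icc a b) = if a ≤ h ∧ h ≤ b then 1 else 0 := by
  have hval : ∀ y, F.extend_mono.stieltjesFunction y = if h ≤ y then 1 else 0 := by
    intro y
    rw [Monotone.stieltjesFunction_eq]
    apply rightLim_eq_of_tendsto
    refine tendsto_const_nhds.congr' ?_
    by_cases hy : h ≤ y
    · filter_upwards [self_mem_nhdsWithin] with z hz
      rw [hF, if_pos hy, if_pos (hy.trans_lt hz)]
    · filter_upwards [nhdsWithin_le_nhds (Iio_mem_nhds (not_le.1 hy))] with z hz
      rw [hF, if_neg hy, if_neg (not_lt.2 (le_of_lt hz))]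
  have hleft : Function.leftLim F.extend_mono.stieltjesFunction a = if h < a then 1 else 0 := by
    apply leftLim_eq_of_tendsto
    refine tendsto_const_nhds.congr' ?_
    by_cases hy : h < a
    · filter_upwards [nhdsWithin_le_nhds (Ioi_mem_nhds hy)] with z hz
      rw [hval, if_pos hy, if_pos (le_of_lt hz)]
    · filter_upwards [self_mem_nhdsWithin] with z hz
      rw [hval, if_neg hy, if_neg (not_le.2 (lt_of_lt_of_le hz (not_lt.1 hy)))]
  rw [UnitCdf.measure, measureReal_def, StieltjesFunction.measure_Icc, hval, hleft]
  split_ifs <;> first | (exfalso; grind) | norm_num [ENNReal.ofReal_of_nonpos]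

namespace FinPerm

theorem stepFunction_extend (σ : FinPerm) {x : unitInterval} (hx : x ≠ 0) (y : ℝ) :
    (σ.stepFunction x).extend y =
      if ((σ.perm (σ.cell x) : ℝ) + 1) / σ.length < y then 1 else 0 := by
  have hn : (0 : ℝ) < σ.length := Nat.cast_pos.2 σ.length_pos
  have h0 : 0 < ((σ.perm (σ.cell x) : ℝ) + 1) / σ.length := by positivity
  have h1 : ((σ.perm (σ.cell x) : ℝ) + 1) / σ.length ≤ 1 := by
    rw [div_le_one hn]
    exact_mod_cast (σ.perm (σ.cell x)).2
  unfold UnitCdf.extend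
  by_cases hy1 : y ≤ 1
  · rw [if_pos hy1]
    by_cases hy0 : y ≤ 0
    · rw [Set.projIcc_of_le_left _ hy0, if_neg (not_lt.2 (hy0.trans h0.le))]
      exact (σ.stepFunction x).map_zero
    · rw [Set.projIcc_of_mem zero_le_one ⟨(not_le.1 hy0).le, hy1⟩]
      have hyne : (⟨y, (not_le.1 hy0).le, hy1⟩ : unitInterval) ≠ 0 := fun h =>
        hy0 (congrArg Subtype.val h).le
      simp only [stepFunction, stepValue, hyne, hx, if_false, adjMatrix]
      have hiff : σ.perm (σ.cell x) < σ.cell ⟨y, (not_le.1 hy0).le, hy1⟩ ↔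
          ((σ.perm (σ.cell x) : ℝ) + 1) / σ.length < y := by
        change (σ.perm (σ.cell x) : ℕ) < ⌈(σ.length : ℝ) * y⌉₊ - 1 ↔ _
        rw [Nat.lt_sub_iff_add_lt, Nat.lt_ceil, div_lt_iff₀ hn]
        push_cast
        rw [mul_comm y]
      simp only [hiff]
  · rw [if_neg hy1, if_pos (h1.trans_lt (not_le.1 hy1))]

/-- The part of the unit interval on which `σ.cell` is the index `a`. -/
def column (σ : FinPerm) (a : Fin σ.length) : Set unitInterval :=
  {x | (a : ℝ) / σ.length < x ∧ (x : ℝ) ≤ ((a : ℝ) + 1) / σ.length}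

theorem column_eq_Ioc (σ : FinPerm) (a : Fin σ.length) :
    ∃ p q : unitInterval, σ.column a = Set.Ioc p q ∧ (p : ℝ) = (a : ℝ) / σ.length ∧
      (q : ℝ) = ((a : ℝ) + 1) / σ.length := by
  have hn : (0 : ℝ) < σ.length := Nat.cast_pos.2 σ.length_pos
  exact ⟨⟨(a : ℝ) / σ.length, by positivity, div_le_one_of_le₀ (Nat.cast_le.2 a.2.le) hn.le⟩,
    ⟨((a : ℝ) + 1) / σ.length, by positivity, div_le_one_of_le₀ (by exact_mod_cast a.2) hn.le⟩,
    rfl, rfl, rfl⟩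

theorem measurableSet_column (σ : FinPerm) (a : Fin σ.length) : MeasurableSet (σ.column a) := by
  obtain ⟨p, q, h, -, -⟩ := σ.column_eq_Ioc a
  rw [h]
  exact measurableSet_Ioc

theorem volume_column (σ : FinPerm) (a : Fin σ.length) :
    (volume : Measure unitInterval).real (σ.column a) = 1 / σ.length := by
  obtain ⟨p, q, h, hp, hq⟩ := σ.column_eq_Ioc a
  rw [h, measureReal_def, unitInterval.volume_Ioc, hp, hq, ← sub_div, add_sub_cancel_left,
    ENNReal.toReal_ofReal (by positivity)]

/-- The point 0 is excluded because it lies in no column, while its `cell` is 0 by truncated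
subtraction. -/
theorem mem_column_iff (σ : FinPerm) {x : unitInterval} (hx : x ≠ 0) (a : Fin σ.length) :
    x ∈ σ.column a ↔ a = σ.cell x := by
  have hn : (0 : ℝ) < σ.length := Nat.cast_pos.2 σ.length_pos
  have hx0 : (0 : ℝ) < x := lt_of_le_of_ne x.2.1 fun h => hx (Subtype.ext h.symm)
  have hpos : 0 < ⌈(σ.length : ℝ) * x⌉₊ := Nat.ceil_pos.2 (mul_pos hn hx0)
  have h1 : (a : ℝ) / σ.length < x ↔ (a : ℕ) < ⌈(σ.length : ℝ) * x⌉₊ := by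
    rw [Nat.lt_ceil, div_lt_iff₀ hn, mul_comm]
  have h2 : (x : ℝ) ≤ ((a : ℝ) + 1) / σ.length ↔ ⌈(σ.length : ℝ) * x⌉₊ ≤ (a : ℕ) + 1 := by
    rw [Nat.ceil_le, le_div_iff₀ hn, mul_comm]
    push_cast
    rfl
  rw [column, Set.mem_ofPred_eq, h1, h2, Fin.ext_iff, cell]
  simp only
  omega

/-- The mass that the step function of `σ` gives to a rectangle. -/
noncomputable def boxMass (σ : FinPerm) (x₁ x₂ α₁ α₂ : unitInterval) : ℝ :=
  ∫ x in Set.Icc x₁ x₂, (σ.stepFunction x).measure.real (Set.Icc (α₁ : ℝ) (α₂ : ℝ))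

/-- Over the column of a the measure is a unit atom at height (σ a + 1)/n; the exceptional point x =
0 is null. -/
theorem boxMass_eq_sum (σ : FinPerm) (x₁ x₂ α₁ α₂ : unitInterval) :
    σ.boxMass x₁ x₂ α₁ α₂ = ∑ a : Fin σ.length,
      (volume : Measure unitInterval).real (Set.Icc x₁ x₂ ∩ σ.column a) *
        if (α₁ : ℝ) ≤ ((σ.perm a : ℝ) + 1) / σ.length ∧
          ((σ.perm a : ℝ) + 1) / σ.length ≤ α₂ then 1 else 0 := by
  have hae : ∀ᵐ x : unitInterval, x ∈ Set.Icc x₁ x₂ →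
      (σ.stepFunction x).measure.real (Set.Icc (α₁ : ℝ) (α₂ : ℝ)) =
      ∑ a : Fin σ.length, (σ.column a).indicator (fun _ =>
        if (α₁ : ℝ) ≤ ((σ.perm a : ℝ) + 1) / σ.length ∧
          ((σ.perm a : ℝ) + 1) / σ.length ≤ α₂ then (1 : ℝ) else 0) x := by
    have h0 : ∀ᵐ x : unitInterval, x ≠ 0 := by
      simp [ae_iff]
    filter_upwards [h0] with x hx _
    rw [UnitCdf.measureReal_Icc_of_extend (σ.stepFunction_extend hx)]
    simp only [Set.indicator, σ.mem_column_iff hx]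
    simp
  rw [boxMass, setIntegral_congr_ae measurableSet_Icc hae, integral_finsetSum]
  · refine Finset.sum_congr rfl fun a _ => ?_
    rw [setIntegral_indicator (σ.measurableSet_column a), setIntegral_const, smul_eq_mul]
  · intro a _
    exact (integrable_const _).indicator (σ.measurableSet_column a)

theorem volume_inter_column_le (σ : FinPerm) (s : Set unitInterval) (a : Fin σ.length) :
    (volume : Measure unitInterval).real (s ∩ σ.column a) ≤ 1 / σ.length :=
  (measureReal_mono Set.inter_subset_right).trans (σ.volume_column a).le

theorem boxMass_nonneg (σ : FinPerm) (x₁ x₂ α₁ α₂ : unitInterval) :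
    0 ≤ σ.boxMass x₁ x₂ α₁ α₂ :=
  integral_nonneg fun _ => measureReal_nonneg

/-- Columns have width 1/n and distinct columns carry atoms at distinct heights. -/
theorem boxMass_le_card (σ : FinPerm) (x₁ x₂ α₁ α₂ : unitInterval) :
    σ.boxMass x₁ x₂ α₁ α₂ ≤ (Finset.card {b : Fin σ.length |
      (α₁ : ℝ) ≤ ((b : ℝ) + 1) / σ.length ∧ ((b : ℝ) + 1) / σ.length ≤ α₂} : ℝ) / σ.length := by
  rw [boxMass_eq_sum, ← Finset.sum_boole, Finset.sum_div,
    ← Equiv.sum_comp σ.perm fun b : Fin σ.length => (if (α₁ : ℝ) ≤ ((b : ℝ) + 1) / σ.length ∧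
      ((b : ℝ) + 1) / σ.length ≤ α₂ then (1 : ℝ) else 0) / σ.length]
  refine Finset.sum_le_sum fun a _ => ?_
  have := σ.volume_inter_column_le (Set.Icc x₁ x₂) a
  split_ifs
  · simpa using this
  · simp

theorem boxMass_le_one (σ : FinPerm) (x₁ x₂ α₁ α₂ : unitInterval) :
    σ.boxMass x₁ x₂ α₁ α₂ ≤ 1 := by
  refine (σ.boxMass_le_card x₁ x₂ α₁ α₂).trans ?_
  apply div_le_one_of_le₀ _ (Nat.cast_nonneg _)
  exact_mod_cast (Finset.card_filter_le _ _).trans (by simp)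

theorem le_boxMass (σ : FinPerm) (a : Fin σ.length) {x₁ x₂ α₁ α₂ : unitInterval}
    (hx : σ.column a ⊆ Set.Icc x₁ x₂) (h1 : (α₁ : ℝ) ≤ ((σ.perm a : ℝ) + 1) / σ.length)
    (h2 : ((σ.perm a : ℝ) + 1) / σ.length ≤ α₂) :
    1 / (σ.length : ℝ) ≤ σ.boxMass x₁ x₂ α₁ α₂ := by
  rw [boxMass_eq_sum]
  refine le_trans (le_of_eq ?_) (Finset.single_le_sum (fun a _ => ?_) (Finset.mem_univ a))
  · rw [if_pos ⟨h1, h2⟩, Set.inter_eq_right.2 hx, volume_column, mul_one]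
  · exact mul_nonneg measureReal_nonneg (by split_ifs <;> simp)

theorem abs_boxMass_sub_le_rectDist (σ π : FinPerm) {x₁ x₂ α₁ α₂ : unitInterval}
    (hx : x₁ < x₂) (hα : α₁ < α₂) :
    |σ.boxMass x₁ x₂ α₁ α₂ - π.boxMass x₁ x₂ α₁ α₂| ≤ rectDist σ π := by
  -- The real supremum is meaningful only for a bounded set; 1 is a bound since both masses lie in
  -- [0, 1].
  refine le_csSup ⟨1, ?_⟩ ⟨x₁, x₂, α₁, α₂, hx, hα, rfl⟩
  rintro r ⟨x₁, x₂, α₁, α₂, -, -, rfl⟩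
  change |σ.boxMass x₁ x₂ α₁ α₂ - π.boxMass x₁ x₂ α₁ α₂| ≤ 1
  have h1 := σ.boxMass_nonneg x₁ x₂ α₁ α₂
  have h2 := π.boxMass_nonneg x₁ x₂ α₁ α₂
  have h3 := σ.boxMass_le_one x₁ x₂ α₁ α₂
  have h4 := π.boxMass_le_one x₁ x₂ α₁ α₂
  rw [abs_le]; constructor <;> linarith

theorem rectDist_le (σ π : FinPerm) {c : ℝ} (hc : 0 ≤ c)
    (h : ∀ x₁ x₂ α₁ α₂ : unitInterval, x₁ < x₂ → α₁ < α₂ →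
      |σ.boxMass x₁ x₂ α₁ α₂ - π.boxMass x₁ x₂ α₁ α₂| ≤ c) : rectDist σ π ≤ c := by
  refine Real.sSup_le ?_ hc
  rintro r ⟨x₁, x₂, α₁, α₂, hx, hα, rfl⟩
  exact h _ _ _ _ hx hα

theorem rectDist_self (σ : FinPerm) : rectDist σ σ = 0 := by
  refine le_antisymm (σ.rectDist_le σ le_rfl fun _ _ _ _ _ _ => by simp) ?_
  exact (abs_nonneg _).trans (σ.abs_boxMass_sub_le_rectDist σ (zero_lt_one : (0 : unitInterval) < 1)
    (zero_lt_one : (0 : unitInterval) < 1))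

theorem rectDist_comm (σ π : FinPerm) : rectDist σ π = rectDist π σ := by
  unfold rectDist cdfRectDist
  simp only [abs_sub_comm]

/-! ### Rectangle masses as second differences of cumulative masses -/

/-- The cumulative mass function of the graph of a permutation. -/
noncomputable def cumulative (σ : FinPerm) (x y : ℝ) : ℝ :=
  σ.graphAverage (stepBelow x) (stepBelow y)

theorem card_touch_le (n : ℕ) (x : ℝ) :
    (∑ a : Fin n, if (a : ℝ) / n ≤ x ∧ x ≤ ((a : ℝ) + 1) / n then (1 : ℝ) else 0) ≤ 2 := by
  rcases Nat.eq_zero_or_pos n with rfl | hn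
  · simp
  have hn' : (0 : ℝ) < n := Nat.cast_pos.2 hn
  rw [Finset.sum_boole]
  have := card_filter_le_of_mem_Icc
    (fun a : Fin n => (a : ℝ) / n ≤ x ∧ x ≤ ((a : ℝ) + 1) / n) (x := x - 1 / n) (y := x)
    (by have : 0 < 1 / (n : ℝ) := by positivity
        linarith)
    (fun a h => ⟨by rw [add_div] at h; linarith [h.2], h.1⟩)
  have h2 : (n : ℝ) * (x - (x - 1 / n)) + 1 = 2 := by field_simp; norm_num
  linarith

/-- If the closed column avoids both endpoints, it is inside or outside the interval and the two
quantities agree. Otherwise both lie in [0, 1], and the right-hand side is at least 1. -/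
theorem abs_column_sub_step_le (σ : FinPerm) {x₁ x₂ : unitInterval} (hx : x₁ ≤ x₂)
    (a : Fin σ.length) :
    |σ.length * (volume : Measure unitInterval).real (Set.Icc x₁ x₂ ∩ σ.column a) -
        (stepBelow x₂ ((a : ℝ) / σ.length) - stepBelow x₁ ((a : ℝ) / σ.length))| ≤
      (if (a : ℝ) / σ.length ≤ x₁ ∧ (x₁ : ℝ) ≤ ((a : ℝ) + 1) / σ.length then (1 : ℝ) else 0) +
      if (a : ℝ) / σ.length ≤ x₂ ∧ (x₂ : ℝ) ≤ ((a : ℝ) + 1) / σ.length then (1 : ℝ) else 0 := by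
  have hn : (0 : ℝ) < σ.length := Nat.cast_pos.2 σ.length_pos
  have hx' : (x₁ : ℝ) ≤ x₂ := hx
  have hL1 : σ.length * (volume : Measure unitInterval).real (Set.Icc x₁ x₂ ∩ σ.column a) ≤ 1 := by
    have := mul_le_mul_of_nonneg_left (σ.volume_inter_column_le (Set.Icc x₁ x₂) a) hn.le
    rwa [mul_one_div_cancel hn.ne'] at this
  have hL0 : 0 ≤ σ.length * (volume : Measure unitInterval).real (Set.Icc x₁ x₂ ∩ σ.column a) :=
    mul_nonneg hn.le measureReal_nonneg
  have hlt : (a : ℝ) / σ.length < ((a : ℝ) + 1) / σ.length := by gcongr; linarith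
  have hin : (x₁ : ℝ) < (a : ℝ) / σ.length → ((a : ℝ) + 1) / σ.length < x₂ →
      σ.length * (volume : Measure unitInterval).real (Set.Icc x₁ x₂ ∩ σ.column a) = 1 := by
    intro h1 h2
    rw [Set.inter_eq_right.2, volume_column, mul_one_div_cancel hn.ne']
    intro t ht
    exact ⟨show (x₁ : ℝ) ≤ t from (h1.trans ht.1).le, show (t : ℝ) ≤ x₂ from ht.2.trans h2.le⟩
  have hout : ((a : ℝ) + 1) / σ.length < x₁ ∨ (x₂ : ℝ) < (a : ℝ) / σ.length →
      σ.length * (volume : Measure unitInterval).real (Set.Icc x₁ x₂ ∩ σ.column a) = 0 := by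
    intro h
    have : Set.Icc x₁ x₂ ∩ σ.column a = ∅ := by
      refine Set.eq_empty_of_forall_notMem fun t ht => ?_
      have h1 : (x₁ : ℝ) ≤ t := ht.1.1
      have h2 : (t : ℝ) ≤ x₂ := ht.1.2
      rcases h with h | h
      · linarith [ht.2.2]
      · linarith [ht.2.1]
    simp [this]
  generalize σ.length * (volume : Measure unitInterval).real (Set.Icc x₁ x₂ ∩ σ.column a) = L at *
  generalize (a : ℝ) / σ.length = u at *
  generalize ((a : ℝ) + 1) / σ.length = v at *
  unfold stepBelow
  rw [abs_le]
  rcases lt_or_ge (x₁ : ℝ) u with h1 | h1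
  · rcases lt_or_ge v (x₂ : ℝ) with h2 | h2
    · rw [hin h1 h2]
      constructor <;> split_ifs <;> linarith
    · rcases lt_or_ge (x₂ : ℝ) u with h3 | h3
      · rw [hout (Or.inr h3)]
        constructor <;> split_ifs <;> linarith
      · rw [if_pos (⟨h3, h2⟩ : u ≤ (x₂ : ℝ) ∧ (x₂ : ℝ) ≤ v)]
        constructor <;> split_ifs <;> linarith
  · rcases lt_or_ge v (x₁ : ℝ) with h2 | h2
    · rw [hout (Or.inl h2)]
      constructor <;> split_ifs <;> linarith
    · rw [if_pos (⟨h1, h2⟩ : u ≤ (x₁ : ℝ) ∧ (x₁ : ℝ) ≤ v)]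
      constructor <;> split_ifs <;> linarith

/-- The atom sits at the upper end of its row, while the cumulative mass samples the lower end; a
threshold separates them only if it lies in the closed row. -/
theorem abs_row_sub_step_le (n : ℕ) {α₁ α₂ : ℝ} (hα : α₁ ≤ α₂) (b : Fin n) :
    |(if α₁ ≤ ((b : ℝ) + 1) / n ∧ ((b : ℝ) + 1) / n ≤ α₂ then (1 : ℝ) else 0) -
        (stepBelow α₂ ((b : ℝ) / n) - stepBelow α₁ ((b : ℝ) / n))| ≤
      (if (b : ℝ) / n ≤ α₁ ∧ α₁ ≤ ((b : ℝ) + 1) / n then (1 : ℝ) else 0) +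
      if (b : ℝ) / n ≤ α₂ ∧ α₂ ≤ ((b : ℝ) + 1) / n then (1 : ℝ) else 0 := by
  have hlt : (b : ℝ) / n ≤ ((b : ℝ) + 1) / n := by gcongr; linarith
  generalize (b : ℝ) / n = u at *
  generalize ((b : ℝ) + 1) / n = v at *
  unfold stepBelow
  rw [abs_le]
  constructor <;> split_ifs <;> first | (norm_num; done) | (exfalso; grind)

/-- Up to `8 / n`, the mass of a rectangle is the second difference of the cumulative mass. -/
theorem abs_boxMass_sub_cumulative_le (σ : FinPerm) {x₁ x₂ α₁ α₂ : unitInterval}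
    (hx : x₁ ≤ x₂) (hα : α₁ ≤ α₂) :
    |σ.boxMass x₁ x₂ α₁ α₂ - (σ.cumulative x₂ α₂ - σ.cumulative x₁ α₂ -
      σ.cumulative x₂ α₁ + σ.cumulative x₁ α₁)| ≤ 8 / σ.length := by
  have hn : (0 : ℝ) < σ.length := Nat.cast_pos.2 σ.length_pos
  set T : unitInterval → Fin σ.length → ℝ := fun x a =>
    if (a : ℝ) / σ.length ≤ x ∧ (x : ℝ) ≤ ((a : ℝ) + 1) / σ.length then 1 else 0 with hT
  have hTsum : ∀ x, ∑ a, T x a ≤ 2 := fun x => card_touch_le _ _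
  have hTsum' : ∀ x, ∑ a, T x (σ.perm a) ≤ 2 := fun x => by
    rw [Equiv.sum_comp σ.perm (T x)]; exact hTsum x
  have hexp : σ.boxMass x₁ x₂ α₁ α₂ - (σ.cumulative x₂ α₂ - σ.cumulative x₁ α₂ -
      σ.cumulative x₂ α₁ + σ.cumulative x₁ α₁) =
      (∑ a : Fin σ.length,
        (σ.length * (volume : Measure unitInterval).real (Set.Icc x₁ x₂ ∩ σ.column a) *
          (if (α₁ : ℝ) ≤ ((σ.perm a : ℝ) + 1) / σ.length ∧
            ((σ.perm a : ℝ) + 1) / σ.length ≤ α₂ then 1 else 0) -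
        (stepBelow x₂ ((a : ℝ) / σ.length) - stepBelow x₁ ((a : ℝ) / σ.length)) *
        (stepBelow α₂ ((σ.perm a : ℝ) / σ.length) -
          stepBelow α₁ ((σ.perm a : ℝ) / σ.length)))) / σ.length := by
    rw [boxMass_eq_sum]
    unfold cumulative graphAverage
    rw [eq_div_iff hn.ne', ← sub_div, ← sub_div, ← add_div, sub_mul, div_mul_cancel₀ _ hn.ne',
      Finset.sum_mul, ← Finset.sum_sub_distrib, ← Finset.sum_sub_distrib, ← Finset.sum_add_distrib,
      ← Finset.sum_sub_distrib]
    exact Finset.sum_congr rfl fun a _ => by ring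
  rw [hexp, abs_div, abs_of_pos hn]
  gcongr
  calc _ ≤ ∑ a : Fin σ.length, (T x₁ a + T x₂ a + (T α₁ (σ.perm a) + T α₂ (σ.perm a))) := by
        refine (Finset.abs_sum_le_sum_abs _ _).trans (Finset.sum_le_sum fun a _ => ?_)
        have h1 := σ.abs_column_sub_step_le hx a
        have h2 := abs_row_sub_step_le σ.length (show (α₁ : ℝ) ≤ α₂ from hα) (σ.perm a)
        set L := σ.length * (volume : Measure unitInterval).real (Set.Icc x₁ x₂ ∩ σ.column a)
          with hLdef
        set φ := (if (α₁ : ℝ) ≤ ((σ.perm a : ℝ) + 1) / σ.length ∧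
            ((σ.perm a : ℝ) + 1) / σ.length ≤ α₂ then (1 : ℝ) else 0) with hφ
        set S := stepBelow x₂ ((a : ℝ) / σ.length) - stepBelow x₁ ((a : ℝ) / σ.length) with hS
        set S' := stepBelow α₂ ((σ.perm a : ℝ) / σ.length) -
          stepBelow α₁ ((σ.perm a : ℝ) / σ.length) with hS'
        have hφ1 : |φ| ≤ 1 := by rw [hφ]; split_ifs <;> simp
        have hS1 : |S| ≤ 1 := by
          rw [hS]; unfold stepBelow; split_ifs <;> simp
        calc |L * φ - S * S'| = |(L - S) * φ + S * (φ - S')| := by ring_nf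
          _ ≤ |L - S| * |φ| + |S| * |φ - S'| := by
            rw [← abs_mul, ← abs_mul]; exact abs_add_le _ _
          _ ≤ |L - S| * 1 + 1 * |φ - S'| := by gcongr
          _ ≤ _ := by rw [mul_one, one_mul]; exact add_le_add h1 h2
    _ ≤ 8 := by
        -- Four endpoints, each touched by at most two closed cells.
        simp only [Finset.sum_add_distrib]
        linarith [hTsum x₁, hTsum x₂, hTsum' α₁, hTsum' α₂]

/-- Moving a threshold changes the step function only between its two positions. The constants are
the weights 1 and 2 of `graphAverage_sub_le`. -/
theorem abs_cumulative_sub_le (σ : FinPerm) {x x' y y' : ℝ} (hx : x ≤ x') (hy : y ≤ y') :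
    |σ.cumulative x y - σ.cumulative x' y'| ≤ (x' - x) + 2 * (y' - y) + 3 / σ.length := by
  have hstep : ∀ {s s' : ℝ}, s ≤ s' →
      gridAverage σ.length (fun t => |stepBelow s t - stepBelow s' t|) ≤
        (s' - s) + 1 / σ.length := by
    intro s s' hs
    have := gridAverage_le_of_support σ.length_pos (h := fun t => |stepBelow s t - stepBelow s' t|)
      (c := 0) hs (fun t _ _ => by simp only [stepBelow]; split_ifs <;> simp)
      (fun t _ _ h => by
        simp only [stepBelow]
        split_ifs <;> first | (simp; done) | (exfalso; grind))
    linarith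
  have h := σ.graphAverage_sub_le (f := stepBelow x) (f' := stepBelow x') (g := stepBelow y)
    (g' := stepBelow y') (fun t _ _ => by unfold stepBelow; split_ifs <;> simp)
    (fun t _ _ => by unfold stepBelow; split_ifs <;> simp)
  have h1 := hstep hx
  have h2 := hstep hy
  have h3 : (3 : ℝ) / σ.length = 3 * (1 / σ.length) := by ring
  unfold cumulative
  linarith

theorem cumulative_of_nonpos (σ : FinPerm) {x y : ℝ} (h : x ≤ 0 ∨ y ≤ 0) :
    σ.cumulative x y = 0 := by
  unfold cumulative graphAverage
  rw [Finset.sum_eq_zero, zero_div]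
  intro a _
  rw [mul_eq_zero]
  refine h.imp (fun h => ?_) fun h => ?_ <;>
  · rw [stepBelow, if_neg (not_lt.2 (h.trans (by positivity)))]

end FinPerm

/-! ### Lengths not tending to infinity -/

theorem tendsto_eq_of_frequently_eq {u : ℕ → ℝ} {l c : ℝ} (h : Tendsto u atTop (𝓝 l))
    (hf : ∃ᶠ n in atTop, u n = c) : l = c := by
  by_contra hne
  exact hf (h.eventually_ne hne)

theorem SameOrder.comp_monotone {ι A B : Type*} [LinearOrder A] [LinearOrder B] {b : A → B}
    (hb : Monotone b) {u : ι → A} (hu : Function.Injective (b ∘ u)) : SameOrder (b ∘ u) u := by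
  intro i j
  refine ⟨fun h => hb.reflect_lt h, fun h => ?_⟩
  exact lt_of_le_of_ne (hb h.le) fun heq => h.ne (congrArg u (hu heq))

namespace FinPerm

theorem finite_length_le (L : ℕ) : {π : FinPerm | π.length ≤ L}.Finite := by
  refine (Set.finite_range fun s : Σ n : Fin L, Equiv.Perm (Fin (n + 1)) =>
    (⟨s.1 + 1, Nat.succ_pos _, s.2⟩ : FinPerm)).subset ?_
  rintro ⟨n, hn, π⟩ h
  obtain ⟨m, rfl⟩ : ∃ m, n = m + 1 := ⟨n - 1, by omega⟩
  exact ⟨⟨⟨m, h⟩, π⟩, rfl⟩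

/-- A convergent sequence of permutations whose lengths do not tend to infinity is eventually
constant. -/
theorem Convergent.eventually_const {σ : ℕ → FinPerm} (hc : Convergent σ)
    (hσ : ¬ Tendsto (fun n => (σ n).length) atTop atTop) : ∃ π, ∀ᶠ n in atTop, σ n = π := by
  rw [tendsto_atTop] at hσ
  push Not at hσ
  obtain ⟨L, hL⟩ := hσ
  -- Pigeonhole: only finitely many permutations have length at most L.
  obtain ⟨π, hπ⟩ : ∃ π, ∃ᶠ n in atTop, σ n = π := by
    by_contra hcon
    push Not at hcon
    have := (eventually_all_finite (finite_length_le L)).2 fun π _ => hcon π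
    obtain ⟨n, hn, hn'⟩ := (hL.and_eventually this).exists
    exact hn' (σ n) hn.le rfl
  have hlim : ∀ τ, Tendsto (fun n => density τ (σ n)) atTop (𝓝 (density τ π)) := by
    intro τ
    obtain ⟨l, hl⟩ := hc τ
    rwa [tendsto_eq_of_frequently_eq hl (hπ.mono fun n hn => by rw [hn])] at hl
  -- In a permutation longer than π these densities sum to at least 1, so eventually no term is
  -- longer than π; then positive density of π forces equality.
  have hsum : Tendsto (fun n => ∑ τ : Equiv.Perm (Fin (π.length + 1)),
      density ⟨π.length + 1, Nat.succ_pos _, τ⟩ (σ n)) atTop (𝓝 0) := by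
    have h0 : ∀ τ : Equiv.Perm (Fin (π.length + 1)),
        density ⟨π.length + 1, Nat.succ_pos _, τ⟩ π = 0 := fun τ => by simp [density]
    have := tendsto_finsetSum Finset.univ fun (τ : Equiv.Perm (Fin (π.length + 1))) _ =>
      hlim ⟨π.length + 1, Nat.succ_pos _, τ⟩
    simpa [h0] using this
  refine ⟨π, ?_⟩
  filter_upwards [hsum.eventually (gt_mem_nhds zero_lt_one),
    (hlim π).eventually (lt_mem_nhds (density_self_pos π))] with n h1 h2
  refine (eq_of_density_pos h2 ?_).symm
  by_contra hlen
  exact absurd h1 (not_lt.2 (one_le_sum_density (σ n) _ _ (by omega)))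

/-- A thin horizontal strip just below height 1/|σ| contains the lowest atom level of σ and at most
one level of π. -/
theorem inv_sub_inv_le_rectDist (σ π : FinPerm) :
    1 / (σ.length : ℝ) - 1 / π.length ≤ rectDist σ π := by
  have hn : (0 : ℝ) < σ.length := Nat.cast_pos.2 σ.length_pos
  have hm : (0 : ℝ) < π.length := Nat.cast_pos.2 π.length_pos
  set h : ℝ := 1 / σ.length with hh
  -- The first bound keeps the strip inside [0, 1]; the second makes it thinner than the spacing of
  -- the levels of π.
  set δ : ℝ := min (h / 2) (1 / (2 * π.length)) with hδdef
  have hh0 : 0 < h := by positivity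
  have hδ0 : 0 < δ := by positivity
  have hδ1 : δ ≤ h / 2 := min_le_left _ _
  have hδ2 : δ ≤ 1 / (2 * π.length) := min_le_right _ _
  have hh1 : h ≤ 1 := by
    rw [hh, div_le_one hn]; exact_mod_cast σ.length_pos
  let α₁ : unitInterval := ⟨h - δ, by linarith, by linarith⟩
  let α₂ : unitInterval := ⟨h, hh0.le, hh1⟩
  have hval : ((σ.perm (σ.perm.symm ⟨0, σ.length_pos⟩) : ℝ) + 1) / σ.length = h := by
    simp [hh]
  have h1 := σ.le_boxMass (σ.perm.symm ⟨0, σ.length_pos⟩) (x₁ := 0) (x₂ := 1) (α₁ := α₁)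
    (α₂ := α₂) (fun x _ => ⟨x.2.1, x.2.2⟩) (by rw [hval]; change h - δ ≤ h; linarith)
    (by rw [hval])
  have h2 : π.boxMass 0 1 α₁ α₂ ≤ 1 / π.length := by
    refine (π.boxMass_le_card 0 1 α₁ α₂).trans ?_
    gcongr
    refine Nat.cast_le_one.2 (Finset.card_le_one.2 ?_)
    have key : ∀ b c : Fin π.length, h - δ ≤ ((b : ℝ) + 1) / π.length →
        ((c : ℝ) + 1) / π.length ≤ h → c ≤ b := by
      intro b c hb hc
      have hlt : ((c : ℝ) + 1) / π.length - ((b : ℝ) + 1) / π.length < 1 / π.length := by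
        have : 1 / (2 * (π.length : ℝ)) < 1 / π.length := by gcongr; linarith
        linarith
      rw [← sub_div, div_lt_div_iff_of_pos_right hm] at hlt
      have : (c : ℝ) < b + 1 := by linarith
      exact Fin.le_def.2 (Nat.lt_succ_iff.1 (by exact_mod_cast this))
    intro b hb c hc
    simp only [Finset.mem_filter, Finset.mem_univ, true_and] at hb hc
    exact le_antisymm (key _ _ hc.1 hb.2) (key _ _ hb.1 hc.2)
  have h3 := (le_abs_self _).trans (σ.abs_boxMass_sub_le_rectDist π
    (x₁ := 0) (x₂ := 1) (α₁ := α₁) (α₂ := α₂) zero_lt_one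
    (Subtype.mk_lt_mk.2 (by linarith)))
  linarith

/-- Where σ a ≠ π a, take column a and a strip of half a level ending at the atom of σ: it holds
mass 1/n for σ and none for π. -/
theorem inv_le_rectDist_of_length_eq {σ π : FinPerm} (hne : σ ≠ π) (hl : σ.length = π.length) :
    1 / (σ.length : ℝ) ≤ rectDist σ π := by
  obtain ⟨n, hn, σ⟩ := σ
  obtain ⟨m, hm, π⟩ := π
  obtain rfl : n = m := hl
  obtain ⟨a, ha⟩ : ∃ a, σ a ≠ π a := by
    by_contra hcon
    push Not at hcon
    exact hne (by rw [Equiv.ext hcon])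
  have hn' : (0 : ℝ) < n := Nat.cast_pos.2 hn
  obtain ⟨p, q, hpq, hp, hq⟩ := column_eq_Ioc ⟨n, hn, σ⟩ a
  simp only at hp hq
  have hs0 : 1 / (n : ℝ) ≤ ((σ a : ℝ) + 1) / n := by
    gcongr; linarith [(Nat.cast_nonneg (σ a : ℕ) : (0 : ℝ) ≤ _)]
  have hs1 : ((σ a : ℝ) + 1) / n ≤ 1 := by
    rw [div_le_one hn']; exact_mod_cast (σ a).2
  have hhalf : 1 / (2 * (n : ℝ)) = 1 / n / 2 := by field_simp
  have hpos : 0 < 1 / (n : ℝ) := by positivity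
  let α₁ : unitInterval := ⟨((σ a : ℝ) + 1) / n - 1 / (2 * n), by linarith, by linarith⟩
  let α₂ : unitInterval := ⟨((σ a : ℝ) + 1) / n, by linarith, hs1⟩
  have h1 := le_boxMass ⟨n, hn, σ⟩ a (x₁ := p) (x₂ := q) (α₁ := α₁) (α₂ := α₂)
    (by rw [hpq]; exact Set.Ioc_subset_Icc_self)
    (by change ((σ a : ℝ) + 1) / n - 1 / (2 * n) ≤ ((σ a : ℝ) + 1) / n; linarith) le_rfl
  have h2 : boxMass ⟨n, hm, π⟩ p q α₁ α₂ = 0 := by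
    rw [boxMass_eq_sum]
    refine Finset.sum_eq_zero fun b _ => ?_
    by_cases hb : b = a
    · subst hb
      rw [if_neg, mul_zero]
      rintro ⟨h3, h4⟩
      change ((σ b : ℝ) + 1) / n - 1 / (2 * n) ≤ ((π b : ℝ) + 1) / n at h3
      change ((π b : ℝ) + 1) / n ≤ ((σ b : ℝ) + 1) / n at h4
      rw [div_le_div_iff_of_pos_right hn'] at h4
      have h5 : ((σ b : ℝ) + 1) / n - ((π b : ℝ) + 1) / n < 1 / n := by linarith
      rw [← sub_div, div_lt_div_iff_of_pos_right hn'] at h5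
      have h6 : (π b : ℕ) ≤ σ b := by exact_mod_cast (by linarith : (π b : ℝ) ≤ σ b)
      have h7 : (σ b : ℕ) < π b + 1 := by
        exact_mod_cast (by linarith : (σ b : ℝ) < π b + 1)
      exact ha (Fin.ext (by omega))
    -- The closed interval exceeds column a only by its left endpoint, a null set.
    · have hsub : Set.Icc p q ∩ column ⟨n, hm, π⟩ b ⊆ {p} := by
        rintro x ⟨hx, hxb⟩
        by_contra hxp
        have hx0 : x ≠ 0 := by
          rintro rfl
          have : (b : ℝ) / n < 0 := hxb.1
          exact absurd this (not_lt.2 (by positivity))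
        have hxa : x ∈ column ⟨n, hm, π⟩ a := by
          change x ∈ column ⟨n, hn, σ⟩ a
          rw [hpq]
          exact ⟨lt_of_le_of_ne hx.1 fun h => hxp h.symm, hx.2⟩
        exact hb (((mem_column_iff _ hx0 b).1 hxb).trans ((mem_column_iff ⟨n, hm, π⟩ hx0 a).1 hxa).symm)
      have : (volume : Measure unitInterval).real (Set.Icc p q ∩ column ⟨n, hm, π⟩ b) = 0 :=
        le_antisymm ((measureReal_mono hsub).trans (by simp [measureReal_def])) measureReal_nonneg
      rw [this, zero_mul]
  have hpq' : p < q := Subtype.coe_lt_coe.1 (by rw [hp, hq]; gcongr; linarith)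
  have h3 := (le_abs_self _).trans (abs_boxMass_sub_le_rectDist ⟨n, hn, σ⟩ ⟨n, hm, π⟩
    (x₁ := p) (x₂ := q) (α₁ := α₁) (α₂ := α₂) hpq'
    (Subtype.mk_lt_mk.2 (by linarith)))
  rw [h2, sub_zero] at h3
  exact h1.trans h3

/-- Permutations are isolated points for the rectangular distance. -/
theorem le_rectDist_of_ne {σ π : FinPerm} (hne : σ ≠ π) :
    1 / ((σ.length : ℝ) * (σ.length + 1)) ≤ rectDist σ π := by
  have hn : (0 : ℝ) < σ.length := Nat.cast_pos.2 σ.length_pos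
  have hm : (0 : ℝ) < π.length := Nat.cast_pos.2 π.length_pos
  rcases lt_trichotomy σ.length π.length with h | h | h
  · refine le_trans ?_ (inv_sub_inv_le_rectDist σ π)
    have h1 : (σ.length : ℝ) + 1 ≤ π.length := by exact_mod_cast h
    have h2 : 1 / (π.length : ℝ) ≤ 1 / (σ.length + 1) := by gcongr
    have h3 : 1 / ((σ.length : ℝ) * (σ.length + 1)) = 1 / σ.length - 1 / (σ.length + 1) := by
      field_simp; ring
    linarith
  · refine le_trans ?_ (inv_le_rectDist_of_length_eq hne h)
    gcongr
    nlinarith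
  · rw [rectDist_comm]
    refine le_trans ?_ (inv_sub_inv_le_rectDist π σ)
    have h1 : (π.length : ℝ) + 1 ≤ σ.length := by exact_mod_cast h
    rw [div_sub_div _ _ hm.ne' hn.ne', div_le_div_iff₀ (by positivity) (by positivity)]
    have h2 : (π.length : ℝ) * σ.length ≤ σ.length * (σ.length + 1) := by nlinarith
    have h3 : (1 : ℝ) ≤ 1 * σ.length - π.length * 1 := by linarith
    calc _ = 1 * ((π.length : ℝ) * σ.length) := rfl
      _ ≤ (1 * σ.length - π.length * 1) * (σ.length * (σ.length + 1)) := by gcongr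

/-- Arbitrarily late terms have length below L, and the isolation radius depends only on the length,
so all terms near such a late one coincide with it. -/
theorem RectCauchy.eventually_const {σ : ℕ → FinPerm} (hc : RectCauchy σ)
    (hσ : ¬ Tendsto (fun n => (σ n).length) atTop atTop) : ∃ π, ∀ᶠ n in atTop, σ n = π := by
  rw [tendsto_atTop] at hσ
  push Not at hσ
  obtain ⟨L, hL⟩ := hσ
  -- Using `L + 1` keeps the radius positive even for L = 0.
  obtain ⟨N, hN⟩ := hc (1 / ((L + 1 : ℝ) * (L + 1 + 1))) (by positivity)
  obtain ⟨n, hn, hnN⟩ := (hL.and_eventually (eventually_ge_atTop N)).exists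
  refine ⟨σ n, ?_⟩
  filter_upwards [eventually_ge_atTop N] with m hm
  by_contra hne
  have h1 := le_rectDist_of_ne (Ne.symm hne)
  have h2 := hN n m hnN hm
  have h3 : ((σ n).length : ℝ) ≤ L + 1 := by
    have : ((σ n).length : ℝ) ≤ L := by exact_mod_cast hn.le
    linarith
  have hpos : (0 : ℝ) < (σ n).length := Nat.cast_pos.2 (σ n).length_pos
  have h4 : 1 / ((L + 1 : ℝ) * (L + 1 + 1)) ≤
      1 / (((σ n).length : ℝ) * ((σ n).length + 1)) := by gcongr
  linarith

theorem convergent_of_eventually_const {σ : ℕ → FinPerm} {π : FinPerm}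
    (h : ∀ᶠ n in atTop, σ n = π) : Convergent σ := fun τ =>
  ⟨density τ π, tendsto_const_nhds.congr' (h.mono fun n hn => by simp only [hn])⟩

theorem rectCauchy_of_eventually_const {σ : ℕ → FinPerm} {π : FinPerm}
    (h : ∀ᶠ n in atTop, σ n = π) : RectCauchy σ := by
  intro ε hε
  obtain ⟨N, hN⟩ := eventually_atTop.1 h
  exact ⟨N, fun n m hn hm => by rwa [hN n hn, hN m hm, rectDist_self]⟩

/-! ### Cumulative masses and the rectangular distance -/

/-- Pointwise convergence of the cumulative mass functions is uniform. -/
theorem cumulative_uniform_cauchy {σ : ℕ → FinPerm}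
    (hσ : Tendsto (fun n => (σ n).length) atTop atTop)
    (hc : ∀ x y, HasLimit fun n => (σ n).cumulative x y) {ε : ℝ} (hε : 0 < ε) :
    ∃ N, ∀ m ≥ N, ∀ n ≥ N, ∀ x y : unitInterval,
      |(σ m).cumulative x y - (σ n).cumulative x y| ≤ ε := by
  -- Rounding down to the grid costs 3/M + 3/n ≤ ε/4 + ε/8 for each of the two permutations; the
  -- grid values contribute ε/4.
  obtain ⟨M, hM⟩ := exists_nat_gt (12 / ε)
  have hM0 : (0 : ℝ) < M := lt_trans (by positivity) hM
  have hM1 : 1 / (M : ℝ) ≤ ε / 12 := by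
    rw [div_lt_iff₀ hε] at hM
    rw [div_le_div_iff₀ hM0 (by norm_num)]
    linarith
  have hgrid : ∀ i j : Fin (M + 1), ∃ N, ∀ m ≥ N, ∀ n ≥ N,
      |(σ m).cumulative (i / M) (j / M) - (σ n).cumulative (i / M) (j / M)| < ε / 4 :=
    fun i j => HasLimit.iff_cauchy.1 (hc _ _) _ (by positivity)
  choose N hN using hgrid
  have hlim : Tendsto (fun n => (1 : ℝ) / ((σ n).length : ℝ)) atTop (𝓝 0) :=
    tendsto_const_nhds.div_atTop (tendsto_natCast_atTop_atTop.comp hσ)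
  obtain ⟨N', hN'⟩ := eventually_atTop.1
    (hlim.eventually (gt_mem_nhds (show 0 < ε / 24 by positivity)))
  refine ⟨max N' (Finset.univ.sup fun p : Fin (M + 1) × Fin (M + 1) => N p.1 p.2),
    fun m hm n hn x y => ?_⟩
  have hround : ∀ x : unitInterval, ∃ i : Fin (M + 1), (i : ℝ) / M ≤ x ∧ (x : ℝ) ≤ i / M + 1 / M := by
    intro x
    have hx0 : 0 ≤ (M : ℝ) * x := mul_nonneg hM0.le x.2.1
    refine ⟨⟨⌊(M : ℝ) * x⌋₊, Nat.lt_succ_iff.2 (Nat.floor_le_of_le ?_)⟩, ?_, ?_⟩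
    · exact mul_le_of_le_one_right hM0.le x.2.2
    · change (⌊(M : ℝ) * x⌋₊ : ℝ) / M ≤ x
      rw [div_le_iff₀ hM0, mul_comm (x : ℝ)]
      exact Nat.floor_le hx0
    · change (x : ℝ) ≤ (⌊(M : ℝ) * x⌋₊ : ℝ) / M + 1 / M
      rw [← add_div, le_div_iff₀ hM0, mul_comm (x : ℝ)]
      exact (Nat.lt_floor_add_one _).le
  obtain ⟨i, hi, hi'⟩ := hround x
  obtain ⟨j, hj, hj'⟩ := hround y
  have hsup : N i j ≤ Finset.univ.sup fun p : Fin (M + 1) × Fin (M + 1) => N p.1 p.2 :=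
    Finset.le_sup (f := fun p : Fin (M + 1) × Fin (M + 1) => N p.1 p.2) (Finset.mem_univ (i, j))
  have h1 := hN i j m (hsup.trans (le_of_max_le_right hm)) n (hsup.trans (le_of_max_le_right hn))
  have h2 := (σ m).abs_cumulative_sub_le hi hj
  have h3 := (σ n).abs_cumulative_sub_le hi hj
  have h4 := hN' m (le_of_max_le_left hm)
  have h5 := hN' n (le_of_max_le_left hn)
  have h6 : (3 : ℝ) / (σ m).length = 3 * (1 / (σ m).length) := by ring
  have h7 : (3 : ℝ) / (σ n).length = 3 * (1 / (σ n).length) := by ring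
  rw [abs_le] at h2 h3 ⊢
  rw [abs_lt] at h1
  constructor <;> linarith [h1.1, h1.2, h2.1, h2.2, h3.1, h3.2]

theorem Convergent.rectCauchy_of_tendsto {σ : ℕ → FinPerm} (hc : Convergent σ)
    (hσ : Tendsto (fun n => (σ n).length) atTop atTop) : RectCauchy σ := by
  intro ε hε
  obtain ⟨N, hN⟩ := cumulative_uniform_cauchy hσ (fun x y => hasLimit_graphAverage_step hσ hc x y)
    (show 0 < ε / 10 by positivity)
  have hlim : Tendsto (fun n => (8 : ℝ) / ((σ n).length : ℝ)) atTop (𝓝 0) :=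
    tendsto_const_nhds.div_atTop (tendsto_natCast_atTop_atTop.comp hσ)
  obtain ⟨N', hN'⟩ := eventually_atTop.1
    (hlim.eventually (gt_mem_nhds (show 0 < ε / 10 by positivity)))
  -- Four corners and two discretisation errors, each at most ε/10.
  refine ⟨max N N', fun n m hn hm => lt_of_le_of_lt (rectDist_le _ _ (c := 6 * (ε / 10))
    (by positivity) fun x₁ x₂ α₁ α₂ hx hα => ?_) (by linarith)⟩
  have h := hN n (le_of_max_le_left hn) m (le_of_max_le_left hm)
  have h1 := abs_le.1 (h x₁ α₁)
  have h2 := abs_le.1 (h x₁ α₂)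
  have h3 := abs_le.1 (h x₂ α₁)
  have h4 := abs_le.1 (h x₂ α₂)
  have h5 := abs_le.1 ((σ n).abs_boxMass_sub_cumulative_le hx.le hα.le)
  have h6 := abs_le.1 ((σ m).abs_boxMass_sub_cumulative_le hx.le hα.le)
  have h7 := hN' n (le_of_max_le_right hn)
  have h8 := hN' m (le_of_max_le_right hm)
  rw [abs_le]
  constructor <;> linarith [h1.1, h1.2, h2.1, h2.2, h3.1, h3.2, h4.1, h4.2, h5.1, h5.2, h6.1, h6.2]

/-- The cumulative mass vanishes on the axes, so its value at (x, y) is the second difference over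
[0, x] × [0, y]. The axes are treated apart because the distance only sees nondegenerate rectangles.
-/
theorem RectCauchy.hasLimit_cumulative {σ : ℕ → FinPerm} (hc : RectCauchy σ)
    (hσ : Tendsto (fun n => (σ n).length) atTop atTop) (x y : unitInterval) :
    HasLimit fun n => (σ n).cumulative x y := by
  by_cases hx : x = 0
  · have : ∀ n, (σ n).cumulative x y = 0 := fun n => cumulative_of_nonpos _ (by simp [hx])
    simpa only [this] using HasLimit.const 0
  by_cases hy : y = 0
  · have : ∀ n, (σ n).cumulative x y = 0 := fun n => cumulative_of_nonpos _ (by simp [hy])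
    simpa only [this] using HasLimit.const 0
  rw [HasLimit.iff_cauchy]
  intro ε hε
  obtain ⟨N, hN⟩ := hc (ε / 3) (by positivity)
  have hlim : Tendsto (fun n => (8 : ℝ) / ((σ n).length : ℝ)) atTop (𝓝 0) :=
    tendsto_const_nhds.div_atTop (tendsto_natCast_atTop_atTop.comp hσ)
  obtain ⟨N', hN'⟩ := eventually_atTop.1
    (hlim.eventually (gt_mem_nhds (show 0 < ε / 3 by positivity)))
  refine ⟨max N N', fun n hn m hm => ?_⟩
  have hx' : (0 : unitInterval) < x := unitInterval.pos_iff_ne_zero.2 hx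
  have hy' : (0 : unitInterval) < y := unitInterval.pos_iff_ne_zero.2 hy
  have h0 : ∀ n, (σ n).cumulative x y - (σ n).cumulative (0 : unitInterval) y -
      (σ n).cumulative x (0 : unitInterval) +
      (σ n).cumulative (0 : unitInterval) (0 : unitInterval) = (σ n).cumulative x y := by
    intro n
    rw [cumulative_of_nonpos _ (x := ((0 : unitInterval) : ℝ)) (y := y) (by simp),
      cumulative_of_nonpos _ (x := x) (y := ((0 : unitInterval) : ℝ)) (by simp),
      cumulative_of_nonpos _ (x := ((0 : unitInterval) : ℝ)) (by simp)]
    ring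
  have h1 := (abs_boxMass_sub_le_rectDist (σ n) (σ m) hx' hy').trans_lt
    (hN n m (le_of_max_le_left hn) (le_of_max_le_left hm))
  have h5 := (σ n).abs_boxMass_sub_cumulative_le hx'.le hy'.le
  have h6 := (σ m).abs_boxMass_sub_cumulative_le hx'.le hy'.le
  have h7 := hN' n (le_of_max_le_right hn)
  have h8 := hN' m (le_of_max_le_right hm)
  rw [h0, abs_le] at h5 h6
  rw [abs_lt] at h1 ⊢
  constructor <;> linarith [h1.1, h1.2, h5.1, h5.2, h6.1, h6.2]

end FinPerm

/-! ### Grid masses and pattern densities -/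

/-- The index of the part containing `a` in the division of `{0, …, n - 1}` into `M` parts. -/
def binIndex {n M : ℕ} (hM : 0 < M) (a : Fin n) : Fin M :=
  ⟨a * M / n, by
    rw [Nat.div_lt_iff_lt_mul a.pos, mul_comm]
    exact Nat.mul_lt_mul_of_pos_left a.2 hM⟩

theorem binIndex_mono {n M : ℕ} (hM : 0 < M) : Monotone (binIndex (n := n) hM) := fun _ _ h =>
  Fin.le_def.2 (Nat.div_le_div_right (Nat.mul_le_mul_right _ h))

theorem binIndex_eq_iff {n M : ℕ} (hM : 0 < M) (a : Fin n) (i : Fin M) :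
    binIndex hM a = i ↔ (i : ℝ) / M ≤ (a : ℝ) / n ∧ (a : ℝ) / n < ((i : ℝ) + 1) / M := by
  have hM' : (0 : ℝ) < M := Nat.cast_pos.2 hM
  have hn' : (0 : ℝ) < n := Nat.cast_pos.2 a.pos
  rw [div_le_div_iff₀ hM' hn', div_lt_div_iff₀ hn' hM', Fin.ext_iff, binIndex]
  simp only
  rw [Nat.div_eq_iff a.pos]
  have : ((a : ℝ) * M < ((i : ℝ) + 1) * n) ↔ (a : ℕ) * M < (i + 1) * n := by norm_cast
  rw [this]
  have : ((i : ℝ) * n ≤ (a : ℝ) * M) ↔ (i : ℕ) * n ≤ a * M := by norm_cast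
  rw [this]
  have hn := a.pos
  have := add_mul (i : ℕ) 1 n
  constructor <;> intro h <;> omega

theorem card_binIndex_le {n M : ℕ} (hM : 0 < M) (i : Fin M) :
    Finset.card {a : Fin n | binIndex hM a = i} ≤ (n + M) / M := by
  have hM' : (0 : ℝ) < M := Nat.cast_pos.2 hM
  rw [Nat.le_div_iff_mul_le hM]
  have h := card_filter_le_of_mem_Icc (fun a : Fin n => binIndex hM a = i)
    (x := (i : ℝ) / M) (y := ((i : ℝ) + 1) / M) (by gcongr; linarith)
    (fun a ha => ⟨((binIndex_eq_iff hM a i).1 ha).1, ((binIndex_eq_iff hM a i).1 ha).2.le⟩)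
  have h2 : (n : ℝ) * (((i : ℝ) + 1) / M - i / M) + 1 = (n + M) / M := by field_simp; ring
  rw [h2, le_div_iff₀ hM'] at h
  exact_mod_cast h

namespace FinPerm

/-- The fraction of the points of the graph of `σ` in a cell of the `M × M` grid. -/
noncomputable def gridMass (σ : FinPerm) {M : ℕ} (hM : 0 < M) (i j : Fin M) : ℝ :=
  (Finset.card {a : Fin σ.length | binIndex hM a = i ∧ binIndex hM (σ.perm a) = j} : ℝ) / σ.length

/-- Cells are half-open on the same side as the strict inequality in `stepBelow`, so there is no
discretisation error. -/
theorem gridMass_eq (σ : FinPerm) {M : ℕ} (hM : 0 < M) (i j : Fin M) :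
    σ.gridMass hM i j = σ.cumulative (((i : ℝ) + 1) / M) (((j : ℝ) + 1) / M) -
      σ.cumulative ((i : ℝ) / M) (((j : ℝ) + 1) / M) -
      σ.cumulative (((i : ℝ) + 1) / M) ((j : ℝ) / M) + σ.cumulative ((i : ℝ) / M) ((j : ℝ) / M) := by
  have hM' : (0 : ℝ) < M := Nat.cast_pos.2 hM
  have hind : ∀ (a : Fin σ.length) (i : Fin M), (if binIndex hM a = i then (1 : ℝ) else 0) =
      stepBelow (((i : ℝ) + 1) / M) ((a : ℝ) / σ.length) -
        stepBelow ((i : ℝ) / M) ((a : ℝ) / σ.length) := by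
    intro a i
    have hlt : (i : ℝ) / M < ((i : ℝ) + 1) / M := by gcongr; linarith
    simp only [binIndex_eq_iff, stepBelow]
    split_ifs <;> first | (norm_num; done) | (exfalso; grind)
  have hprod : ∀ a : Fin σ.length,
      (if binIndex hM a = i ∧ binIndex hM (σ.perm a) = j then (1 : ℝ) else 0) =
      (if binIndex hM a = i then (1 : ℝ) else 0) *
        (if binIndex hM (σ.perm a) = j then (1 : ℝ) else 0) := by
    intro a
    split_ifs <;> simp_all
  rw [gridMass, ← Finset.sum_boole]
  simp only [hprod, hind]
  unfold cumulative graphAverage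
  rw [← sub_div, ← sub_div, ← add_div, ← Finset.sum_sub_distrib, ← Finset.sum_sub_distrib,
    ← Finset.sum_add_distrib]
  congr 1
  exact Finset.sum_congr rfl fun a _ => by ring

-- Group the tuples by the cells they visit: the pattern condition concerns the cells alone, so each
-- fibre is a product of cells.
open Classical in
theorem card_grid_pattern (σ : FinPerm) {M : ℕ} (hM : 0 < M) {k : ℕ} (τ : Equiv.Perm (Fin k)) :
    (Finset.card {z : Fin k → Fin σ.length | StrictMono (binIndex hM ∘ z) ∧
      SameOrder (binIndex hM ∘ σ.perm ∘ z) τ} : ℝ) / (σ.length : ℝ) ^ k =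
    ∑ p : (Fin k → Fin M) × (Fin k → Fin M) with StrictMono p.1 ∧ SameOrder p.2 τ,
      ∏ t, σ.gridMass hM (p.1 t) (p.2 t) := by
  have h1 := Finset.card_eq_sum_card_fiberwise
    (s := Finset.univ.filter fun z : Fin k → Fin σ.length => StrictMono (binIndex hM ∘ z) ∧
      SameOrder (binIndex hM ∘ σ.perm ∘ z) τ)
    (t := Finset.univ.filter fun p : (Fin k → Fin M) × (Fin k → Fin M) =>
      StrictMono p.1 ∧ SameOrder p.2 τ)
    (f := fun z => (binIndex hM ∘ z, binIndex hM ∘ σ.perm ∘ z))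
    (fun z hz => by simpa using hz)
  rw [h1, Nat.cast_sum, Finset.sum_div]
  refine Finset.sum_congr rfl fun p hp => ?_
  have hp' : StrictMono p.1 ∧ SameOrder p.2 τ := by simpa using hp
  have h2 : (Finset.univ.filter fun z : Fin k → Fin σ.length => StrictMono (binIndex hM ∘ z) ∧
      SameOrder (binIndex hM ∘ σ.perm ∘ z) τ).filter
        (fun z => (binIndex hM ∘ z, binIndex hM ∘ σ.perm ∘ z) = p) =
      Fintype.piFinset fun t => Finset.univ.filter fun a : Fin σ.length =>
        binIndex hM a = p.1 t ∧ binIndex hM (σ.perm a) = p.2 t := by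
    ext z
    simp only [Finset.mem_filter, Finset.mem_univ, true_and, Fintype.mem_piFinset, Prod.ext_iff,
      funext_iff, Function.comp]
    constructor
    · rintro ⟨-, h3, h4⟩ t
      exact ⟨h3 t, h4 t⟩
    · intro h
      have h3 : binIndex hM ∘ z = p.1 := funext fun t => (h t).1
      have h4 : binIndex hM ∘ σ.perm ∘ z = p.2 := funext fun t => (h t).2
      refine ⟨⟨?_, ?_⟩, fun t => (h t).1, fun t => (h t).2⟩
      · exact h3 ▸ hp'.1
      · exact h4 ▸ hp'.2
  rw [h2, Fintype.card_piFinset]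
  simp only [gridMass, Finset.prod_div_distrib, Finset.prod_const, Finset.card_univ,
    Fintype.card_fin, Nat.cast_prod]

open Classical in
/-- Pattern occurrences are approximated by products of grid masses. -/
theorem abs_occurrences_sub_le (σ : FinPerm) {M : ℕ} (hM : 0 < M) (τ : FinPerm) :
    |(occurrences τ σ : ℝ) / (σ.length : ℝ) ^ τ.length -
      ∑ p : (Fin τ.length → Fin M) × (Fin τ.length → Fin M) with
        StrictMono p.1 ∧ SameOrder p.2 τ.perm, ∏ t, σ.gridMass hM (p.1 t) (p.2 t)| ≤
      2 * (τ.length : ℝ) ^ 2 * (1 / M + 1 / σ.length) := by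
  obtain ⟨k, hk, τ⟩ := τ
  simp only
  have hn : (0 : ℝ) < σ.length := Nat.cast_pos.2 σ.length_pos
  have hM' : (0 : ℝ) < M := Nat.cast_pos.2 hM
  rw [← card_grid_pattern, ← sub_div]
  have hocc : occurrences ⟨k, hk, τ⟩ σ = Finset.card {z : Fin k → Fin σ.length |
      StrictMono z ∧ SameOrder (σ.perm ∘ z) τ} := by
    rw [occurrences, ← Set.ncard_coe_finset]
    simp only [Finset.coe_filter, Finset.mem_univ, true_and]
    rfl
  have hmono := binIndex_mono (n := σ.length) hM
  have hsub : (Finset.univ.filter fun z : Fin k → Fin σ.length =>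
      StrictMono (binIndex hM ∘ z) ∧ SameOrder (binIndex hM ∘ σ.perm ∘ z) τ) ⊆
      Finset.univ.filter fun z : Fin k → Fin σ.length =>
        StrictMono z ∧ SameOrder (σ.perm ∘ z) τ := by
    intro z hz
    simp only [Finset.mem_filter, Finset.mem_univ, true_and] at hz ⊢
    exact ⟨fun i j hij => hmono.reflect_lt (hz.1 hij),
      (SameOrder.comp_monotone hmono (hz.2.injective τ.injective)).symm.trans hz.2⟩
  -- An occurrence invisible on the grid has two entries sharing a column or a row, and each of
  -- these holds at most n/M + 1 points.
  have hdiff : Finset.card ((Finset.univ.filter fun z : Fin k → Fin σ.length =>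
        StrictMono z ∧ SameOrder (σ.perm ∘ z) τ) \ Finset.univ.filter fun z : Fin k → Fin σ.length =>
      StrictMono (binIndex hM ∘ z) ∧ SameOrder (binIndex hM ∘ σ.perm ∘ z) τ) ≤
      k ^ 2 * (2 * ((σ.length + M) / M) * σ.length ^ (k - 1)) := by
    refine le_trans (Finset.card_le_card ?_) (card_filter_exists_rel_le
      (fun a b => binIndex hM b = binIndex hM a ∨
        binIndex hM (σ.perm b) = binIndex hM (σ.perm a)) (2 * ((σ.length + M) / M)) ?_)
    · intro z hz
      simp only [Finset.mem_sdiff, Finset.mem_filter, Finset.mem_univ, true_and] at hz ⊢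
      by_contra hcon
      push Not at hcon
      obtain ⟨⟨h1, h2⟩, h3⟩ := hz
      refine h3 ⟨fun i j hij => lt_of_le_of_ne (hmono (h1 hij).le) (hcon j i hij.ne').1, ?_⟩
      refine SameOrder.trans (SameOrder.comp_monotone hmono fun i j hij => ?_) h2
      by_contra hne
      exact (hcon j i (Ne.symm hne)).2 hij
    · intro a
      rw [Finset.filter_or, two_mul]
      refine (Finset.card_union_le _ _).trans (add_le_add (card_binIndex_le hM _) ?_)
      refine le_trans (le_of_eq ?_) (card_binIndex_le (n := σ.length) hM (binIndex hM (σ.perm a)))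
      exact Finset.card_bij (fun b _ => σ.perm b) (fun b hb => by simpa using hb)
        (fun b _ c _ h => σ.perm.injective h)
        (fun b hb => ⟨σ.perm.symm b, by simpa using hb, by simp⟩)
  rw [hocc]
  have hcard := Finset.card_sdiff_add_card_eq_card hsub
  rw [← hcard, Nat.cast_add, add_sub_cancel_right, abs_of_nonneg (by positivity),
    div_le_iff₀ (by positivity)]
  have hpow : (σ.length : ℝ) ^ k = (σ.length : ℝ) ^ (k - 1) * σ.length := by
    rw [← pow_succ, Nat.sub_add_cancel hk]
  have hdiv : (((σ.length + M) / M : ℕ) : ℝ) ≤ (σ.length + M) / M := by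
    have := Nat.cast_div_le (α := ℝ) (m := σ.length + M) (n := M)
    simpa using this
  calc _ ≤ ((k ^ 2 * (2 * ((σ.length + M) / M) * σ.length ^ (k - 1)) : ℕ) : ℝ) :=
        Nat.cast_le.2 hdiff
    _ = (k : ℝ) ^ 2 * (2 * (((σ.length + M) / M : ℕ) : ℝ) * (σ.length : ℝ) ^ (k - 1)) := by
        push_cast; ring
    _ ≤ (k : ℝ) ^ 2 * (2 * ((σ.length + M) / M) * (σ.length : ℝ) ^ (k - 1)) := by gcongr
    _ = _ := by rw [hpow]; field_simp

/-- For fixed M the grid approximation is a finite sum of products of convergent cell masses. -/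
theorem RectCauchy.convergent_of_tendsto {σ : ℕ → FinPerm} (hc : RectCauchy σ)
    (hσ : Tendsto (fun n => (σ n).length) atTop atTop) : Convergent σ := by
  classical
  intro τ
  rw [tendsto_density_iff hσ]
  refine HasLimit.of_approx fun ε hε => ?_
  -- This makes the grid error 2k²/M at most ε/2; the remaining 2k²/n is below ε/2 for late terms.
  obtain ⟨M, hM⟩ := exists_nat_gt (4 * (τ.length : ℝ) ^ 2 / ε)
  have hM' : (0 : ℝ) < M := lt_of_le_of_lt (by positivity) hM
  have hM0 : 0 < M := Nat.cast_pos.1 hM'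
  refine ⟨_, HasLimit.sum _ fun p _ => HasLimit.prod Finset.univ fun t _ => ?_,
    Eventually.mono ?_ fun n hn => ((σ n).abs_occurrences_sub_le hM0 τ).trans hn⟩
  · have hpt : ∀ r s : ℕ, r ≤ M → s ≤ M →
        HasLimit fun n => (σ n).cumulative ((r : ℝ) / M) ((s : ℝ) / M) := fun r s hr hs =>
      hc.hasLimit_cumulative hσ
        ⟨(r : ℝ) / M, by positivity, div_le_one_of_le₀ (Nat.cast_le.2 hr) hM'.le⟩
        ⟨(s : ℝ) / M, by positivity, div_le_one_of_le₀ (Nat.cast_le.2 hs) hM'.le⟩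
    simp only [gridMass_eq, ← Nat.cast_add_one]
    exact (((hpt _ _ (p.1 t).2 (p.2 t).2).sub (hpt _ _ (p.1 t).2.le (p.2 t).2)).sub
      (hpt _ _ (p.1 t).2 (p.2 t).2.le)).add (hpt _ _ (p.1 t).2.le (p.2 t).2.le)
  · have hlim : Tendsto (fun n => 2 * (τ.length : ℝ) ^ 2 / ((σ n).length : ℝ)) atTop (𝓝 0) :=
      tendsto_const_nhds.div_atTop (tendsto_natCast_atTop_atTop.comp hσ)
    filter_upwards [hlim.eventually (gt_mem_nhds (show 0 < ε / 2 by positivity))] with n hn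
    have h1 : 2 * (τ.length : ℝ) ^ 2 / M ≤ ε / 2 := by
      rw [div_lt_iff₀ hε] at hM
      rw [div_le_div_iff₀ hM' (by norm_num)]
      linarith
    have h2 : 2 * (τ.length : ℝ) ^ 2 * (1 / M + 1 / (σ n).length) =
        2 * (τ.length : ℝ) ^ 2 / M + 2 * (τ.length : ℝ) ^ 2 / (σ n).length := by ring
    linarith

end FinPerm

theorem theorem1p6 (σ : ℕ → FinPerm) :
    FinPerm.Convergent σ ↔ FinPerm.RectCauchy σ := by
  by_cases hσ : Tendsto (fun n => (σ n).length) atTop atTop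
  · exact ⟨fun h => h.rectCauchy_of_tendsto hσ, fun h => h.convergent_of_tendsto hσ⟩
  · constructor
    · intro h
      obtain ⟨π, hπ⟩ := h.eventually_const hσ
      exact rectCauchy_of_eventually_const hπ
    · intro h
      obtain ⟨π, hπ⟩ := h.eventually_const hσ
      exact convergent_of_eventually_const hπ
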